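/- Let $R$ and $S$ be (associative, unital) rings, let $M$ be an $R$-$S$-bimodule, and let $\Lambda=\begin{pmatrix} S & 0\\ M & R\end{pmatrix}$ be the corresponding triangular matrix ring. Assume that the projective dimension $\mathrm{pd}_R M$ of the left $R$-module $M$ and the flat dimension $\mathrm{fd}\,M_S$ of the right $S$-module $M$ are finite. For a ring $A$, write $A\text{-}\mathrm{Mod}$ for the category of left $A$-modules. A complex $\mathbf I=(\cdots\to I_1\to I_0\to I_{-1}\to\cdots)$ of injective left $A$-modules is called totally acyclic if it is acyclic and $\mathrm{Hom}_A(E,\mathbf I)$ is acyclic for every injective left $A$-module $E$. A left $A$-module $G$ is Gorenstein injective if $G\cong\ker(I_0\to I_{-1})$ for some totally acyclic complex $\mathbf I$ of injective left $A$-modules; $\mathcal{GI}(A)$ denotes the class of Gorenstein injective left $A$-modules. A class $\mathcal Y$ of left $A$-modules is called special preenveloping if for every left $A$-module $N$ there is an injective homomorphism $g:N\to Y$ with $Y\in\mathcal Y$ and $\mathrm{Ext}^1_A(\mathrm{coker}\, g,Y')=0$ for all $Y'\in\mathcal Y$. Then $\mathcal{GI}(\Lambda)$ is special preenveloping in $\Lambda\text{-}\mathrm{Mod}$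 if and only if $\mathcal{GI}(R)$ is special preenveloping in $R\text{-}\mathrm{Mod}$ and $\mathcal{GI}(S)$ is special preenveloping in $S\text{-}\mathrm{Mod}$. -/

import Mathlib

open CategoryTheory CategoryTheory.Limits CategoryTheory.Abelian Opposite TensorProduct

universe w v u

/-! ### Gorenstein injective objects and special preenveloping classes in abelian categories -/

section Abelian

variable {C : Type u} [Category.{v} C] [Abelian C]

/-- A complex `I` (homological grading, indexed by `ℤ`) is a totally acyclic complex of injective
objects: every term is injective, `I` is acyclic, and the complex of abelian groups `Hom(E, I)` is
acyclic for every injective object `E`. -/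
structure IsTotallyAcyclicInjective (I : ChainComplex C ℤ) : Prop where
  injective : ∀ i : ℤ, Injective (I.X i)
  acyclic : I.Acyclic
  hom_acyclic : ∀ E : C, Injective E →
    (((preadditiveCoyoneda.obj (op E)).mapHomologicalComplex (ComplexShape.down ℤ)).obj I).Acyclic

variable (C) in
/-- The class of Gorenstein injective objects of `C`: the objects isomorphic to the kernel
`Z₀(I)` of `I₀ ⟶ I₋₁` for some totally acyclic complex `I` of injective objects. -/
def gorensteinInjective : ObjectProperty C := fun G =>
  ∃ I : ChainComplex C ℤ, IsTotallyAcyclicInjective I ∧ Nonempty (G ≅ I.cycles 0)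

/-- The left orthogonal class `⊥P` with respect to `Ext¹`: the objects `M` such that
`Ext¹(M, Y) = 0` for all `Y` in `P`. -/
def leftExtOrthogonal [HasExt.{w} C] (P : ObjectProperty C) : ObjectProperty C := fun M =>
  ∀ Y : C, P Y → Subsingleton (Ext M Y 1)

/-- `g : M ⟶ Y` is a special `P`-preenvelope: `g` is a monomorphism, `Y` is in `P`, and the
cokernel of `g` lies in `⊥P`. -/
structure IsSpecialPreenvelope [HasExt.{w} C] (P : ObjectProperty C) {M Y : C} (g : M ⟶ Y) :
    Prop where
  mono : Mono g
  mem : P Y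
  cokernel_mem : leftExtOrthogonal P (cokernel g)

/-- The class `P` is special preenveloping: every object has a special `P`-preenvelope. -/
def IsSpecialPreenveloping [HasExt.{w} C] (P : ObjectProperty C) : Prop :=
  ∀ M : C, ∃ (Y : C) (g : M ⟶ Y), IsSpecialPreenvelope P g

end Abelian

/-! ### Flat dimension of right modules over a noncommutative ring

A right `S`-module is a module over `Sᵐᵒᵖ`. -/

section Flat

variable (S : Type u) [Ring S]

/-- The subgroup of `F ⊗[ℤ] N` generated by the elements `(x s) ⊗ n - x ⊗ (s n)`. -/
def balancedRel (F : Type u) [AddCommGroup F] [Module Sᵐᵒᵖ F]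
    (N : Type u) [AddCommGroup N] [Module S N] : AddSubgroup (F ⊗[ℤ] N) :=
  AddSubgroup.closure
    {t | ∃ (x : F) (s : S) (n : N), t = (MulOpposite.op s • x) ⊗ₜ[ℤ] n - x ⊗ₜ[ℤ] (s • n)}

/-- The tensor product `F ⊗_S N` of a right `S`-module `F` and a left `S`-module `N`, an abelian
group. -/
abbrev BalancedTensor (F : Type u) [AddCommGroup F] [Module Sᵐᵒᵖ F]
    (N : Type u) [AddCommGroup N] [Module S N] : Type u :=
  (F ⊗[ℤ] N) ⧸ balancedRel S F N

variable {S} in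
theorem balancedRel_le_comap (F : Type u) [AddCommGroup F] [Module Sᵐᵒᵖ F]
    {N P : Type u} [AddCommGroup N] [Module S N] [AddCommGroup P] [Module S P] (f : N →ₗ[S] P) :
    balancedRel S F N ≤ (balancedRel S F P).comap
      (LinearMap.lTensor F f.toAddMonoidHom.toIntLinearMap).toAddMonoidHom := by
  refine (AddSubgroup.closure_le _).2 ?_
  rintro _ ⟨x, s, n, rfl⟩
  refine AddSubgroup.subset_closure ⟨x, s, f n, ?_⟩
  simp

variable {S} in
/-- The map `F ⊗_S f : F ⊗_S N → F ⊗_S P` induced by an `S`-linear map `f : N → P`. -/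
def BalancedTensor.map (F : Type u) [AddCommGroup F] [Module Sᵐᵒᵖ F]
    {N P : Type u} [AddCommGroup N] [Module S N] [AddCommGroup P] [Module S P] (f : N →ₗ[S] P) :
    BalancedTensor S F N →+ BalancedTensor S F P :=
  QuotientAddGroup.map _ _
    (LinearMap.lTensor F f.toAddMonoidHom.toIntLinearMap).toAddMonoidHom
    (balancedRel_le_comap F f)

/-- A right `S`-module `F` is flat: `F ⊗_S -` preserves injectivity of maps of left
`S`-modules. -/
def IsFlatRight (F : Type u) [AddCommGroup F] [Module Sᵐᵒᵖ F] : Prop :=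
  ∀ (N P : Type u) [AddCommGroup N] [Module S N] [AddCommGroup P] [Module S P] (f : N →ₗ[S] P),
    Function.Injective f → Function.Injective (BalancedTensor.map F f)

/-- `HasFlatDimensionLE S n X`: the right `S`-module `X` has flat dimension at most `n`, i.e.
there is an exact sequence `0 → Fₙ → ⋯ → F₁ → F₀ → X → 0` with all `Fᵢ` flat. The resolution is
given step by step: `X` is a quotient of a flat module `F` by a submodule which has a flat
resolution of length `n - 1`. -/
def HasFlatDimensionLE : ℕ → ModuleCat.{u} Sᵐᵒᵖ → Prop
  | 0, X => IsFlatRight S X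
  | n + 1, X => ∃ (F : ModuleCat.{u} Sᵐᵒᵖ) (p : F →ₗ[Sᵐᵒᵖ] X), IsFlatRight S F ∧
      Function.Surjective p ∧ HasFlatDimensionLE n (ModuleCat.of Sᵐᵒᵖ (LinearMap.ker p))

end Flat

/-! ### Triangular matrix rings -/

/-- The set of matrices `[[s, 0], [m, r]]` with `s ∈ S`, `m ∈ M`, `r ∈ R`. -/
@[ext]
structure TriangularMatrixRing (S M R : Type u) : Type u where
  s : S
  m : M
  r : R

namespace TriangularMatrixRing

section Basic

variable {S M R : Type u} [Ring S] [Ring R] [AddCommGroup M]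

instance : Zero (TriangularMatrixRing S M R) := ⟨⟨0, 0, 0⟩⟩
instance : One (TriangularMatrixRing S M R) := ⟨⟨1, 0, 1⟩⟩
instance : Add (TriangularMatrixRing S M R) := ⟨fun a b => ⟨a.s + b.s, a.m + b.m, a.r + b.r⟩⟩
instance : Neg (TriangularMatrixRing S M R) := ⟨fun a => ⟨-a.s, -a.m, -a.r⟩⟩

@[simp] theorem zero_s : (0 : TriangularMatrixRing S M R).s = 0 := rfl
@[simp] theorem zero_m : (0 : TriangularMatrixRing S M R).m = 0 := rfl
@[simp] theorem zero_r : (0 : TriangularMatrixRing S M R).r = 0 := rfl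
@[simp] theorem one_s : (1 : TriangularMatrixRing S M R).s = 1 := rfl
@[simp] theorem one_m : (1 : TriangularMatrixRing S M R).m = 0 := rfl
@[simp] theorem one_r : (1 : TriangularMatrixRing S M R).r = 1 := rfl
@[simp] theorem add_s (a b : TriangularMatrixRing S M R) : (a + b).s = a.s + b.s := rfl
@[simp] theorem add_m (a b : TriangularMatrixRing S M R) : (a + b).m = a.m + b.m := rfl
@[simp] theorem add_r (a b : TriangularMatrixRing S M R) : (a + b).r = a.r + b.r := rfl
@[simp] theorem neg_s (a : TriangularMatrixRing S M R) : (-a).s = -a.s := rfl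
@[simp] theorem neg_m (a : TriangularMatrixRing S M R) : (-a).m = -a.m := rfl
@[simp] theorem neg_r (a : TriangularMatrixRing S M R) : (-a).r = -a.r := rfl

end Basic

variable {S M R : Type u} [Ring S] [Ring R] [AddCommGroup M] [Module R M] [Module Sᵐᵒᵖ M]

/-- `[[s, 0], [m, r]] * [[s', 0], [m', r']] = [[s s', 0], [m s' + r m', r r']]`. -/
instance : Mul (TriangularMatrixRing S M R) :=
  ⟨fun a b => ⟨a.s * b.s, MulOpposite.op b.s • a.m + a.r • b.m, a.r * b.r⟩⟩

@[simp] theorem mul_s (a b : TriangularMatrixRing S M R) : (a * b).s = a.s * b.s := rfl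
@[simp] theorem mul_m (a b : TriangularMatrixRing S M R) :
    (a * b).m = MulOpposite.op b.s • a.m + a.r • b.m := rfl
@[simp] theorem mul_r (a b : TriangularMatrixRing S M R) : (a * b).r = a.r * b.r := rfl

/-- The triangular matrix ring `[[S, 0], [M, R]]` of an `R`-`S`-bimodule `M`. -/
instance [SMulCommClass R Sᵐᵒᵖ M] : Ring (TriangularMatrixRing S M R) where
  add_assoc a b c := by ext <;> simp [add_assoc]
  zero_add a := by ext <;> simp
  add_zero a := by ext <;> simp
  add_comm a b := by ext <;> simp [add_comm]
  neg_add_cancel a := by ext <;> simp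
  left_distrib a b c := by ext <;> simp [mul_add, add_smul, smul_add]; abel
  right_distrib a b c := by ext <;> simp [add_mul, add_smul, smul_add]; abel
  zero_mul a := by ext <;> simp
  mul_zero a := by ext <;> simp
  mul_assoc a b c := by ext <;> simp [mul_assoc, mul_smul, smul_add, smul_comm, add_assoc]
  one_mul a := by ext <;> simp
  mul_one a := by ext <;> simp
  nsmul := nsmulRec
  zsmul := zsmulRec

end TriangularMatrixRing

/-!
# Special Gorenstein injective preenvelopes over triangular matrix rings

A left module over `Λ = [[S, 0], [M, R]]` is a triple `(X, Y, φ)` with `X` a left `S`-module, `Y` a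
left `R`-module and `φ : X → Hom_R(M, Y)` an `S`-linear map. The functors between `Λ`-modules,
`S`-modules and `R`-modules that matter are collected in a `TriangularRecollement`; the argument is
carried out for such a recollement and only uses the adjunctions and a few short exact sequences.

Gorenstein injective objects are handled by coinduction (`IsGorensteinCoinductive`): they form the
largest class that is `Ext¹`-orthogonal to injectives and in which every object has one-step
injective resolutions to both sides. Hence a functor that preserves injectives, is exact on the
relevant sequences, and whose adjoint maps injectives to objects with vanishing `Ext¹` into
Gorenstein injectives, preserves Gorenstein injectives. The finiteness conditions on `M` enter
only through `IsCompatible`: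

* if `pd M` is finite, `Hom_R(M, -)` is exact on short exact sequences starting in a Gorenstein
  injective module, since `Ext¹(M, G) = 0` for Gorenstein injective `G`;
* if `fd M` is finite, `Hom_R(M, E)` has finite injective dimension over `S` for injective `E`,
  being a direct summand of `Hom_ℤ(M, D)` with `D` divisible. The latter has finite injective dimension
  by Lambek's criterion (`IsFlatRight.injective_rightDual`).

It follows that for a Gorenstein injective triple `(X, Y, φ)` the map `φ` is surjective and both `Y`
and `ker φ` are Gorenstein injective, and that `(X, 0)` and `(Hom_R(M, Y), Y)` are Gorenstein
injective if `X` and `Y` are.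

Given special preenvelopes over `R` and `S`, a triple `(X, Y, φ)` is enlarged in three steps, each
a pushout with cokernel left orthogonal to the Gorenstein injectives: first `Y` is replaced by a
special preenvelope, then `X` is enlarged by a projective module to make `φ` surjective, and finally
`ker φ` is replaced by a special preenvelope. Conversely, a special preenvelope of `(0, Y)`
restricts to one of `Y`. For a special preenvelope `(X, 0) → N` with cokernel `L`, the component of `L` over
`R` is Gorenstein injective and left orthogonal to the Gorenstein injectives, hence injective; this
shows that the kernel of the structure map of `L`, which is the cokernel of the map from `X` to that
of `N`, remains left orthogonal to the Gorenstein injectives.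
-/

/-! ### Short exact sequences -/

section ShortExactSequences

variable {C : Type u} [Category.{v} C] [Abelian C]

/-- `0 ⟶ A ⟶ B ⟶ D ⟶ 0` is a short exact sequence. -/
structure IsSES {A B D : C} (f : A ⟶ B) (g : B ⟶ D) : Prop where
  w : f ≫ g = 0
  shortExact : (ShortComplex.mk f g w).ShortExact

namespace IsSES

variable {A B D : C} {f : A ⟶ B} {g : B ⟶ D}

theorem mono (h : IsSES f g) : Mono f := h.shortExact.mono_f

theorem epi (h : IsSES f g) : Epi g := h.shortExact.epi_g

theorem exists_lift (h : IsSES f g) {T : C} (t : T ⟶ B) (ht : t ≫ g = 0) :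
    ∃ s : T ⟶ A, s ≫ f = t := by
  have := h.mono
  exact ⟨h.shortExact.exact.lift t ht, h.shortExact.exact.lift_f t ht⟩

theorem exists_desc (h : IsSES f g) {T : C} (t : B ⟶ T) (ht : f ≫ t = 0) :
    ∃ s : D ⟶ T, g ≫ s = t := by
  have := h.epi
  exact ⟨h.shortExact.exact.desc t ht, h.shortExact.exact.g_desc t ht⟩

theorem of_kernel [Mono f] [Epi g] (w : f ≫ g = 0)
    (H : ∀ {T : C} (t : T ⟶ B), t ≫ g = 0 → ∃ s : T ⟶ A, s ≫ f = t) : IsSES f g := by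
  refine ⟨w, ShortComplex.ShortExact.mk' (ShortComplex.exact_of_f_is_kernel _
    (KernelFork.IsLimit.ofι' f w fun {T} t ht => ⟨(H t ht).choose, (H t ht).choose_spec⟩)) ‹_› ‹_›⟩

theorem of_cokernel [Mono f] [Epi g] (w : f ≫ g = 0)
    (H : ∀ {T : C} (t : B ⟶ T), f ≫ t = 0 → ∃ s : D ⟶ T, g ≫ s = t) : IsSES f g := by
  refine ⟨w, ShortComplex.ShortExact.mk' (ShortComplex.exact_of_g_is_cokernel _
    (CokernelCofork.IsColimit.ofπ' g w fun {T} t ht =>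
      ⟨(H t ht).choose, (H t ht).choose_spec⟩)) ‹_› ‹_›⟩

theorem of_mono (f : A ⟶ B) [Mono f] : IsSES f (cokernel.π f) :=
  of_cokernel (cokernel.condition f) fun t ht => ⟨cokernel.desc f t ht, by simp⟩

theorem comp_iso_left (h : IsSES f g) {A' : C} (e : A' ≅ A) : IsSES (e.hom ≫ f) g := by
  have := h.mono
  have := h.epi
  refine of_kernel (by simp [h.w]) fun t ht => ?_
  obtain ⟨s, hs⟩ := h.exists_lift t ht
  exact ⟨s ≫ e.inv, by simp [hs]⟩

theorem comp_iso_right (h : IsSES f g) {D' : C} (e : D ≅ D') : IsSES f (g ≫ e.hom) := by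
  have := h.mono
  have := h.epi
  refine of_kernel (by simp [reassoc_of% h.w]) fun t ht => ?_
  exact h.exists_lift t (by simpa [← Category.assoc] using ht)

theorem op (h : IsSES f g) : IsSES g.op f.op :=
  ⟨by rw [← op_comp, h.w]; rfl, h.shortExact.op⟩

theorem unop {A B D : Cᵒᵖ} {f : A ⟶ B} {g : B ⟶ D} (h : IsSES f g) : IsSES g.unop f.unop :=
  ⟨by rw [← unop_comp, h.w]; rfl, h.shortExact.unop⟩

theorem map {D' : Type*} [Category* D'] [Abelian D'] (h : IsSES f g) (F : C ⥤ D')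
    [PreservesFiniteLimits F] [PreservesFiniteColimits F] : IsSES (F.map f) (F.map g) := by
  have : F.Additive := Functor.additive_of_preserves_binary_products F
  exact ⟨by rw [← F.map_comp, h.w, F.map_zero], h.shortExact.map_of_exact F⟩

theorem map_of_epi {D' : Type*} [Category* D'] [Abelian D'] (h : IsSES f g) (F : C ⥤ D')
    [PreservesFiniteLimits F] [Epi (F.map g)] : IsSES (F.map f) (F.map g) := by
  have : F.Additive := Functor.additive_of_preserves_binary_products F
  have := h.mono
  exact ⟨by rw [← F.map_comp, h.w, F.map_zero],
    ShortComplex.ShortExact.mk' ((h.shortExact.exact.map_of_mono_of_preservesKernel F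
      inferInstance inferInstance)) (show Mono (F.map f) from inferInstance) ‹_›⟩

theorem map_of_mono {D' : Type*} [Category* D'] [Abelian D'] (h : IsSES f g) (F : C ⥤ D')
    [PreservesFiniteColimits F] [Mono (F.map f)] : IsSES (F.map f) (F.map g) := by
  have : PreservesBinaryBiproducts F := preservesBinaryBiproducts_of_preservesBinaryCoproducts F
  have : F.Additive := Functor.additive_of_preservesBinaryBiproducts F
  have := h.epi
  exact ⟨by rw [← F.map_comp, h.w, F.map_zero],
    ShortComplex.ShortExact.mk' ((h.shortExact.exact.map_of_epi_of_preservesCokernel F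
      inferInstance inferInstance)) ‹_› (show Epi (F.map g) from inferInstance)⟩

/-- The pushout of a short exact sequence along a morphism out of its first term is a short exact
sequence with the same third term. -/
theorem exists_pushout (h : IsSES f g) {A' : C} (a : A ⟶ A') :
    ∃ (W : C) (f' : A' ⟶ W) (b : B ⟶ W) (g' : W ⟶ D),
      IsPushout f a b f' ∧ b ≫ g' = g ∧ IsSES f' g' := by
  have := h.mono
  have := h.epi
  have hp := IsPushout.of_hasPushout f a
  have hm : Mono (pushout.inr f a) := inferInstance
  have hb : pushout.inl f a ≫ hp.desc g 0 (by simp [h.w]) = g := by simp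
  have he : Epi (hp.desc g 0 (by simp [h.w])) := epi_of_epi_fac hb
  refine ⟨_, _, _, hp.desc g 0 _, hp, hb,
    of_cokernel (by simp) fun t ht => ?_⟩
  obtain ⟨s, hs⟩ := h.exists_desc (pushout.inl f a ≫ t) (by
    rw [hp.w_assoc, ht, comp_zero])
  refine ⟨s, hp.hom_ext ?_ ?_⟩
  · simp [hs]
  · simp [ht]

/-- A pushout of a monomorphism has the same cokernel. -/
theorem of_isPushout {X Y Z W K : C} {a : X ⟶ Y} {q : Y ⟶ K} (h : IsSES a q)
    {f : X ⟶ Z} {b : Z ⟶ W} {f' : Y ⟶ W} (hp : IsPushout f a b f') :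
    ∃ q' : W ⟶ K, f' ≫ q' = q ∧ IsSES b q' := by
  have := h.mono
  have := h.epi
  have hm : Mono b := (MorphismProperty.monomorphisms C).of_isPushout hp
    (MorphismProperty.monomorphisms.infer_property a)
  have hb : f' ≫ hp.desc 0 q (by simp [h.w]) = q := by simp
  have he : Epi (hp.desc 0 q (by simp [h.w])) := epi_of_epi_fac hb
  refine ⟨hp.desc 0 q _, hb, of_cokernel (by simp) fun t ht => ?_⟩
  obtain ⟨s, hs⟩ := h.exists_desc (f' ≫ t) (by rw [← hp.w_assoc, ht, comp_zero])
  refine ⟨s, hp.hom_ext ?_ ?_⟩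
  · simp [ht]
  · simp [hs]

/-- For monomorphisms `A ⟶ B ⟶ B'`, the cokernel of the composition is an extension of the two
cokernels. -/
theorem comp_left (h : IsSES f g) {B' E : C} {i : B ⟶ B'} {p : B' ⟶ E} (h' : IsSES i p) :
    ∃ (Q : C) (q : B' ⟶ Q) (j : D ⟶ Q) (r : Q ⟶ E), IsSES (f ≫ i) q ∧ IsSES j r := by
  have := h.mono
  have := h.epi
  have := h'.mono
  obtain ⟨Q, j, q, r, hp, -, hj⟩ := h'.exists_pushout g
  refine ⟨Q, q, j, r, ?_, hj⟩
  have : Epi q := (MorphismProperty.epimorphisms C).of_isPushout hp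
    (MorphismProperty.epimorphisms.infer_property g)
  refine of_cokernel (by rw [Category.assoc, hp.w, reassoc_of% h.w, zero_comp]) fun t ht => ?_
  obtain ⟨s, hs⟩ := h.exists_desc (i ≫ t) (by simpa using ht)
  exact ⟨hp.desc t s hs.symm, by simp⟩

/-- The horseshoe lemma for one step of a coresolution, in the case where the given monomorphism
`A ⟶ I'` extends along `A ⟶ B`. -/
theorem horseshoe (h : IsSES f g) {I' K' I'' K'' : C} {i' : A ⟶ I'} {p' : I' ⟶ K'}
    (h' : IsSES i' p') {i'' : D ⟶ I''} {p'' : I'' ⟶ K''} (h'' : IsSES i'' p'')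
    (e : B ⟶ I') (he : f ≫ e = i') :
    ∃ (V Q : C) (a : I' ⟶ V) (b : V ⟶ I'') (i : B ⟶ V) (p : V ⟶ Q) (c : K' ⟶ Q) (d : Q ⟶ K''),
      IsSES a b ∧ IsSES i p ∧ IsSES c d := by
  have := h.epi
  have := h'.epi
  have := h''.epi
  have := h''.mono
  have := h'.mono
  have hm : Mono (biprod.lift e g) := by
    refine Preadditive.mono_of_cancel_zero _ fun t ht => ?_
    have h1 : t ≫ e = 0 := by simpa using ht =≫ biprod.fst
    have h2 : t ≫ g = 0 := by simpa using ht =≫ biprod.snd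
    obtain ⟨s, rfl⟩ := h.exists_lift t h2
    rw [Category.assoc, he] at h1
    rw [zero_of_comp_mono i' h1, zero_comp]
  -- The cokernel of `(e, g) : B ⟶ I' ⊞ D` is the cokernel `K'` of `i'`.
  obtain ⟨s, hs⟩ := h.exists_desc (e ≫ p') (by rw [reassoc_of% he, h'.w])
  have h1 : IsSES (biprod.lift e g) (biprod.desc p' (-s)) := by
    have : Epi (biprod.desc p' (-s)) := epi_of_epi_fac (biprod.inl_desc p' (-s))
    refine of_cokernel (by simp [hs]) fun t ht => ?_
    have ht' : e ≫ biprod.inl ≫ t + g ≫ biprod.inr ≫ t = 0 := by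
      rw [← ht, biprod.lift_eq]; simp
    obtain ⟨x, hx⟩ := h'.exists_desc (biprod.inl ≫ t) (by
      have := f ≫= ht'
      simpa [reassoc_of% he, reassoc_of% h.w] using this)
    have h3 : s ≫ x + biprod.inr ≫ t = 0 := by
      rw [← cancel_epi g, Preadditive.comp_add, reassoc_of% hs, hx, ht', comp_zero]
    refine ⟨x, ?_⟩
    ext
    · simp [hx]
    · simp [eq_neg_of_add_eq_zero_right h3]
  have h2 : IsSES (biprod.map (𝟙 I') i'') (biprod.snd ≫ p'') := by
    refine of_kernel (by simp [h''.w]) fun t ht => ?_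
    obtain ⟨x, hx⟩ := h''.exists_lift (t ≫ biprod.snd) (by simpa using ht)
    refine ⟨biprod.lift (t ≫ biprod.fst) x, ?_⟩
    ext <;> simp [hx]
  obtain ⟨Q, q, j, r, hq, hj⟩ := h1.comp_left h2
  refine ⟨_, Q, biprod.inl, biprod.snd, _, q, j, r, ?_, hq, hj⟩
  exact of_kernel (by simp) fun t ht => ⟨t ≫ biprod.fst, by ext <;> simp [ht]⟩

end IsSES

end ShortExactSequences

/-! ### Vanishing of `Ext` -/

section ExtVanishing

variable {C : Type u} [Category.{v} C] [Abelian C] [HasExt.{w} C]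

namespace IsSES

variable {A B D : C} {f : A ⟶ B} {g : B ⟶ D}

theorem subsingleton_ext_covariant₂ (h : IsSES f g) (X : C) (n : ℕ)
    (hA : Subsingleton (Ext X A n)) (hD : Subsingleton (Ext X D n)) :
    Subsingleton (Ext X B n) := by
  refine subsingleton_of_forall_eq 0 fun x => ?_
  obtain ⟨y, rfl⟩ := Ext.covariant_sequence_exact₂ X h.shortExact x (Subsingleton.elim _ _)
  rw [Subsingleton.elim y 0, Ext.zero_comp]

theorem subsingleton_ext_covariant₁ (h : IsSES f g) (X : C) (n : ℕ)
    (hD : Subsingleton (Ext X D n)) (hB : Subsingleton (Ext X B (n + 1))) :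
    Subsingleton (Ext X A (n + 1)) := by
  refine subsingleton_of_forall_eq 0 fun x => ?_
  obtain ⟨y, rfl⟩ := Ext.covariant_sequence_exact₁ X h.shortExact x (Subsingleton.elim _ _) rfl
  rw [Subsingleton.elim y 0, Ext.zero_comp]

theorem subsingleton_ext_covariant₃ (h : IsSES f g) (X : C) (n : ℕ)
    (hB : Subsingleton (Ext X B n)) (hA : Subsingleton (Ext X A (n + 1))) :
    Subsingleton (Ext X D n) := by
  refine subsingleton_of_forall_eq 0 fun x => ?_
  obtain ⟨y, rfl⟩ := Ext.covariant_sequence_exact₃ X h.shortExact x rfl (Subsingleton.elim _ _)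
  rw [Subsingleton.elim y 0, Ext.zero_comp]

theorem subsingleton_ext_contravariant₂ (h : IsSES f g) (Y : C) (n : ℕ)
    (hA : Subsingleton (Ext A Y n)) (hD : Subsingleton (Ext D Y n)) :
    Subsingleton (Ext B Y n) := by
  refine subsingleton_of_forall_eq 0 fun x => ?_
  obtain ⟨y, rfl⟩ := Ext.contravariant_sequence_exact₂ h.shortExact Y x (Subsingleton.elim _ _)
  rw [Subsingleton.elim y 0, Ext.comp_zero]

theorem subsingleton_ext_contravariant₁ (h : IsSES f g) (Y : C) (n : ℕ)
    (hB : Subsingleton (Ext B Y n)) (hD : Subsingleton (Ext D Y (n + 1))) :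
    Subsingleton (Ext A Y n) := by
  refine subsingleton_of_forall_eq 0 fun x => ?_
  obtain ⟨y, rfl⟩ := Ext.contravariant_sequence_exact₁ h.shortExact Y x (add_comm 1 n)
    (Subsingleton.elim _ _)
  rw [Subsingleton.elim y 0, Ext.comp_zero]

/-- If `Ext¹(X, A) = 0`, then morphisms out of `X` lift along epimorphisms with kernel `A`. -/
theorem exists_lift_of_ext (h : IsSES f g) {X : C} (hX : Subsingleton (Ext X A 1)) (t : X ⟶ D) :
    ∃ s : X ⟶ B, s ≫ g = t := by
  obtain ⟨y, hy⟩ := Ext.covariant_sequence_exact₃ X h.shortExact (Ext.mk₀ t) (zero_add 1)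
    (Subsingleton.elim _ _)
  obtain ⟨s, rfl⟩ := (Ext.mk₀_bijective X B).2 y
  exact ⟨s, (Ext.mk₀_bijective X D).1 (by simpa using hy)⟩

/-- Computing `Ext¹(X, A)` from a short exact sequence `0 ⟶ A ⟶ B ⟶ D ⟶ 0` with `B` injective:
it vanishes once every morphism `X ⟶ D` lifts to `B`. -/
theorem subsingleton_ext_one_of_injective (h : IsSES f g) [Injective B] {X : C}
    (H : ∀ t : X ⟶ D, ∃ s : X ⟶ B, s ≫ g = t) : Subsingleton (Ext X A 1) := by
  refine subsingleton_of_forall_eq 0 fun x => ?_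
  obtain ⟨y, rfl⟩ := Ext.covariant_sequence_exact₁ X h.shortExact x
    ((Ext.subsingleton_of_injective X B 0).elim _ _) (zero_add 1)
  obtain ⟨t, rfl⟩ := (Ext.mk₀_bijective X D).2 y
  obtain ⟨s, rfl⟩ := H t
  have h0 : (Ext.mk₀ g).comp h.shortExact.extClass (zero_add 1) = 0 :=
    h.shortExact.comp_extClass
  rw [← Ext.mk₀_comp_mk₀_assoc, h0, Ext.comp_zero]

omit [HasExt.{w} C] in
theorem injective_middle (h : IsSES f g) [Injective A] [Injective D] : Injective B := by
  rw [injective_iff_hasInjectiveDimensionLT_one]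
  exact h.shortExact.hasInjectiveDimensionLT_X₂ 1 (inferInstanceAs (HasInjectiveDimensionLT A 1))
    (inferInstanceAs (HasInjectiveDimensionLT D 1))

/-- `Ext¹` and a pair of adjoint functors `F ⊣ G`: if `G` is exact on one short exact sequence that
embeds `A` into an injective object `G`-acyclically, then `Ext¹(F X, A)` vanishes exactly when
`Ext¹(X, G A)` does. -/
theorem subsingleton_ext_one_adjunction {C' : Type*} [Category* C'] [Abelian C']
    [HasExt.{w} C'] (h : IsSES f g) [Injective B] {F : C' ⥤ C} {G : C ⥤ C'} (adj : F ⊣ G)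
    [F.PreservesMonomorphisms] (hG : IsSES (G.map f) (G.map g)) (X : C') :
    Subsingleton (Ext (F.obj X) A 1) ↔ Subsingleton (Ext X (G.obj A) 1) := by
  have : Injective (G.obj B) := Injective.injective_of_adjoint adj B
  constructor
  · intro hX
    refine hG.subsingleton_ext_one_of_injective fun t => ?_
    obtain ⟨s, hs⟩ := h.exists_lift_of_ext hX ((adj.homEquiv X D).symm t)
    refine ⟨adj.homEquiv X B s, ?_⟩
    rw [← adj.homEquiv_naturality_right, hs, Equiv.apply_symm_apply]
  · intro hX
    refine h.subsingleton_ext_one_of_injective fun t => ?_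
    obtain ⟨s, hs⟩ := hG.exists_lift_of_ext hX (adj.homEquiv X D t)
    refine ⟨(adj.homEquiv X B).symm s, ?_⟩
    rw [← adj.homEquiv_naturality_right_symm, hs, Equiv.symm_apply_apply]

end IsSES

theorem subsingleton_ext_of_iso_left {X X' : C} (e : X ≅ X') {Y : C} {n : ℕ}
    (h : Subsingleton (Ext X Y n)) : Subsingleton (Ext X' Y n) := by
  refine subsingleton_of_forall_eq 0 fun x => ?_
  have h1 : (Ext.mk₀ e.inv).comp ((Ext.mk₀ e.hom).comp x (zero_add n)) (zero_add n) = x := by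
    simp
  rw [← h1, Subsingleton.elim ((Ext.mk₀ e.hom).comp x (zero_add n)) 0, Ext.comp_zero]

theorem subsingleton_ext_of_iso_right {X Y Y' : C} (e : Y ≅ Y') {n : ℕ}
    (h : Subsingleton (Ext X Y n)) : Subsingleton (Ext X Y' n) := by
  refine subsingleton_of_forall_eq 0 fun x => ?_
  have h1 : (x.comp (Ext.mk₀ e.inv) (add_zero n)).comp (Ext.mk₀ e.hom) (add_zero n) = x := by
    simp
  rw [← h1, Subsingleton.elim (x.comp (Ext.mk₀ e.inv) (add_zero n)) 0, Ext.zero_comp]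

end ExtVanishing

/-! ### Gorenstein injective objects -/

section GorensteinInjective

variable {C : Type u} [Category.{v} C] [Abelian C] [HasExt.{w} C]

/-- A class `P` of objects is a *Gorenstein injective coinduction class* if each of its members is
`Ext¹`-orthogonal to the injective objects, is a quotient of an injective object with kernel in `P`,
and embeds into an injective object with cokernel in `P`. The class of Gorenstein injective objects
is the largest such class. -/
structure IsGorensteinCoinductive (P : ObjectProperty C) : Prop where
  ext {G : C} (hG : P G) (E : C) [Injective E] : Subsingleton (Ext E G 1)
  left {G : C} (hG : P G) : ∃ (G' I : C) (i : G' ⟶ I) (p : I ⟶ G),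
    P G' ∧ Injective I ∧ IsSES i p
  right {G : C} (hG : P G) : ∃ (I G' : C) (i : G ⟶ I) (p : I ⟶ G'),
    P G' ∧ Injective I ∧ IsSES i p

/-- Splicing short exact sequences `G (n + 1) ⟶ I n ⟶ G n` with injective middle terms and with
`Ext¹(E, G n) = 0` for injective `E` gives a totally acyclic complex. -/
theorem gorensteinInjective_of_splicing (G I : ℤ → C) (i : ∀ n, G (n + 1) ⟶ I n)
    (p : ∀ n, I n ⟶ G n) (hI : ∀ n, Injective (I n)) (hS : ∀ n, IsSES (i n) (p n))
    (hE : ∀ (E : C) [Injective E] (n : ℤ), Subsingleton (Ext E (G n) 1)) :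
    gorensteinInjective C (G 1) := by
  have hm (n) := (hS n).mono
  have he (n) := (hS n).epi
  let d (n : ℤ) : I (n + 1) ⟶ I n := p (n + 1) ≫ i n
  have hd (n : ℤ) : d (n + 1) ≫ d n = 0 := by simp [d, reassoc_of% (hS (n + 1)).w]
  let K : ChainComplex C ℤ := ChainComplex.of I d hd
  have hK (n : ℤ) : K.d (n + 1) n = p (n + 1) ≫ i n := ChainComplex.of_d I d n
  have hprev (n : ℤ) : (ComplexShape.down ℤ).prev n = n + 1 := by simp
  have hnext (n : ℤ) : (ComplexShape.down ℤ).next (n + 1) = n := by simp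
  have hZ (n : ℤ) : Nonempty (G (n + 1 + 1) ≅ K.cycles (n + 1)) := by
    have w : i (n + 1) ≫ K.d (n + 1) n = 0 := by rw [hK, reassoc_of% (hS (n + 1)).w, zero_comp]
    refine ⟨IsLimit.conePointUniqueUpToIso (KernelFork.IsLimit.ofι' _ w fun {T} t ht => ?_)
      (K.cyclesIsKernel (n + 1) n (hnext n))⟩
    have ht' : t ≫ p (n + 1) = 0 := by
      rw [← cancel_mono (i n), Category.assoc, zero_comp, ← hK]; exact ht
    exact ⟨((hS (n + 1)).exists_lift t ht').choose, ((hS (n + 1)).exists_lift t ht').choose_spec⟩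
  have hZ' (n a b : ℤ) (ha : a = b + 1) (hb : b = n + 1) : Nonempty (G a ≅ K.cycles b) := by
    subst ha hb
    exact hZ n
  refine ⟨K, ⟨hI, fun n => ?_, fun E hE' n => ?_⟩, hZ' (-1) 1 0 (by simp) (by simp)⟩
  · obtain ⟨n, rfl⟩ : ∃ m, n = m + 1 := ⟨n - 1, by ring⟩
    rw [K.exactAt_iff' (n + 1 + 1) (n + 1) n (hprev _) (hnext _),
      ShortComplex.exact_iff_exact_up_to_refinements]
    intro A (x : A ⟶ I (n + 1)) (hx : x ≫ K.d (n + 1) n = 0)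
    rw [hK, ← Category.assoc, ← zero_comp (f := i n), cancel_mono] at hx
    obtain ⟨s, hs⟩ := (hS (n + 1)).exists_lift x hx
    obtain ⟨A', π, hπ, y, hy⟩ := surjective_up_to_refinements_of_epi (p (n + 1 + 1)) s
    exact ⟨A', π, hπ, y, by
      change π ≫ x = y ≫ K.d (n + 1 + 1) (n + 1)
      rw [hK, ← hs, reassoc_of% hy]⟩
  · obtain ⟨n, rfl⟩ : ∃ m, n = m + 1 := ⟨n - 1, by ring⟩
    rw [HomologicalComplex.exactAt_iff' _ (n + 1 + 1) (n + 1) n (hprev _) (hnext _),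
      ShortComplex.ab_exact_iff]
    intro (x : E ⟶ I (n + 1)) (hx : x ≫ K.d (n + 1) n = 0)
    rw [hK, ← Category.assoc, ← zero_comp (f := i n), cancel_mono] at hx
    obtain ⟨s, hs⟩ := (hS (n + 1)).exists_lift x hx
    obtain ⟨y, hy⟩ := (hS (n + 1 + 1)).exists_lift_of_ext (hE E (n + 1 + 1 + 1)) s
    refine ⟨y, ?_⟩
    change y ≫ K.d (n + 1 + 1) (n + 1) = x
    rw [hK, ← hs, reassoc_of% hy]

/-- The coinduction principle for Gorenstein injective objects: splicing the short exact sequences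
provided by `P` in both directions gives a totally acyclic complex. -/
theorem IsGorensteinCoinductive.le_gorensteinInjective {P : ObjectProperty C}
    (hP : IsGorensteinCoinductive P) : P ≤ gorensteinInjective C := by
  intro G hG
  -- `l` and `r` move one step to the left and to the right in the complex to be built.
  let l (X : {X : C // P X}) : {X : C // P X} :=
    ⟨_, (hP.left X.2).choose_spec.choose_spec.choose_spec.choose_spec.1⟩
  let r (X : {X : C // P X}) : {X : C // P X} :=
    ⟨_, (hP.right X.2).choose_spec.choose_spec.choose_spec.choose_spec.1⟩
  let Rel (X Y : {X : C // P X}) : Prop :=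
    ∃ (I : C) (i : X.1 ⟶ I) (p : I ⟶ Y.1), Injective I ∧ IsSES i p
  have hl (X) : Rel (l X) X :=
    ⟨_, _, _, (hP.left X.2).choose_spec.choose_spec.choose_spec.choose_spec.2⟩
  have hr (X) : Rel X (r X) :=
    ⟨_, _, _, (hP.right X.2).choose_spec.choose_spec.choose_spec.choose_spec.2⟩
  let g : ℤ → {X : C // P X}
    | .ofNat n => l^[n] ⟨G, hG⟩
    | .negSucc n => r^[n + 1] ⟨G, hG⟩
  have hg (n : ℤ) : Rel (g (n + 1)) (g n) := by
    match n with
    | .ofNat n =>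
      change Rel (l^[n + 1] _) (l^[n] _)
      rw [Function.iterate_succ_apply']
      exact hl _
    | .negSucc 0 => exact hr _
    | .negSucc (n + 1) =>
      change Rel (r^[n + 1] _) (r^[n + 1 + 1] _)
      rw [Function.iterate_succ_apply' r (n + 1)]
      exact hr _
  have hg' (n : ℤ) : Rel (g (n + 1 - 1)) (g (n - 1)) := by
    have := hg (n - 1)
    rwa [show n - 1 + 1 = n + 1 - 1 by ring] at this
  choose I i p hI hS using hg'
  exact gorensteinInjective_of_splicing (fun n => (g (n - 1)).1) I i p hI hS
    fun E _ n => hP.ext (g (n - 1)).2 E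

variable (C) in
theorem isGorensteinCoinductive_gorensteinInjective :
    IsGorensteinCoinductive (gorensteinInjective C) := by
  let P : ObjectProperty C := fun G => ∃ I : ChainComplex C ℤ, IsTotallyAcyclicInjective I ∧
    ∃ n : ℤ, Nonempty (G ≅ I.cycles n)
  -- All cycles of totally acyclic complexes together form a coinductive class; by
  -- `le_gorensteinInjective` the degree of the cycles does not matter.
  have key (I : ChainComplex C ℤ) (hI : IsTotallyAcyclicInjective I) (n : ℤ) :
      ∃ p : I.X (n + 1) ⟶ I.cycles n, IsSES (I.iCycles (n + 1)) p ∧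
        p ≫ I.iCycles n = I.d (n + 1) n := by
    have hnext : (ComplexShape.down ℤ).next (n + 1) = n := by simp
    have hprev : (ComplexShape.down ℤ).prev n = n + 1 := by simp
    have he : Epi (I.toCycles (n + 1) n) := by
      rw [epi_iff_surjective_up_to_refinements]
      intro A y
      obtain ⟨A', π, hπ, x, hx⟩ := (I.exactAt_iff_exact_up_to_refinements (n + 1) n (n - 1)
        hprev (by simp)).1 (hI.acyclic n) (y ≫ I.iCycles n) (by simp)
      exact ⟨A', π, hπ, x, by rw [← cancel_mono (I.iCycles n)]; simpa using hx⟩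
    refine ⟨I.toCycles (n + 1) n, .of_kernel ?_ fun t ht => ?_, by simp⟩
    · rw [← cancel_mono (I.iCycles n)]; simp
    · exact ⟨I.liftCycles t n hnext (by rw [← I.toCycles_i, reassoc_of% ht, zero_comp]), by simp⟩
  have hext (I : ChainComplex C ℤ) (hI : IsTotallyAcyclicInjective I) (n : ℤ) (E : C)
      (hE : Injective E) : Subsingleton (Ext E (I.cycles n) 1) := by
    obtain ⟨n, rfl⟩ : ∃ m, n = m + 1 := ⟨n - 1, by ring⟩
    obtain ⟨p, hS, hp⟩ := key I hI n
    have := hI.injective (n + 1)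
    refine hS.subsingleton_ext_one_of_injective fun t => ?_
    have hex := hI.hom_acyclic E hE n
    rw [HomologicalComplex.exactAt_iff' _ (n + 1) n (n - 1) (by simp) (by simp),
      ShortComplex.ab_exact_iff] at hex
    have h0 : (t ≫ I.iCycles n) ≫ I.d n (n - 1) = 0 := by simp
    obtain ⟨(y : E ⟶ I.X (n + 1)), hy⟩ := hex (t ≫ I.iCycles n) h0
    have hy' : y ≫ I.d (n + 1) n = t ≫ I.iCycles n := hy
    exact ⟨y, by rw [← cancel_mono (I.iCycles n), Category.assoc, hp, hy']⟩
  have hP : IsGorensteinCoinductive P := by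
    refine ⟨?_, ?_, ?_⟩
    · rintro G ⟨I, hI, n, ⟨e⟩⟩ E hE
      exact subsingleton_ext_of_iso_right e.symm (hext I hI n E hE)
    · rintro G ⟨I, hI, n, ⟨e⟩⟩
      obtain ⟨p, hS, hp⟩ := key I hI n
      exact ⟨_, _, _, _, ⟨I, hI, n + 1, ⟨Iso.refl _⟩⟩, hI.injective _, hS.comp_iso_right e.symm⟩
    · rintro G ⟨I, hI, n, ⟨e⟩⟩
      obtain ⟨n, rfl⟩ : ∃ m, n = m + 1 := ⟨n - 1, by ring⟩
      obtain ⟨p, hS, hp⟩ := key I hI n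
      exact ⟨_, _, _, _, ⟨I, hI, n, ⟨Iso.refl _⟩⟩, hI.injective _,
        hS.comp_iso_left e⟩
  have hle : gorensteinInjective C ≤ P := by
    rintro G ⟨I, hI, ⟨e⟩⟩
    exact ⟨I, hI, 0, ⟨e⟩⟩
  have hge := hP.le_gorensteinInjective
  refine ⟨fun hG => hP.ext (hle _ hG), fun hG => ?_, fun hG => ?_⟩
  · obtain ⟨G', I, i, p, hG', h⟩ := hP.left (hle _ hG)
    exact ⟨G', I, i, p, hge _ hG', h⟩
  · obtain ⟨I, G', i, p, hG', h⟩ := hP.right (hle _ hG)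
    exact ⟨I, G', i, p, hge _ hG', h⟩

omit [HasExt.{w} C] in
theorem gorensteinInjective_of_iso {G G' : C} (e : G ≅ G') (hG : gorensteinInjective C G) :
    gorensteinInjective C G' := by
  obtain ⟨I, hI, ⟨e'⟩⟩ := hG
  exact ⟨I, hI, ⟨e.symm ≪≫ e'⟩⟩

/-- All higher `Ext` groups from an injective to a Gorenstein injective object vanish. -/
theorem subsingleton_ext_injective_gorensteinInjective {E G : C} [Injective E]
    (hG : gorensteinInjective C G) (n : ℕ) : Subsingleton (Ext E G (n + 1)) := by
  have hC := isGorensteinCoinductive_gorensteinInjective C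
  induction n generalizing G with
  | zero => exact hC.ext hG E
  | succ n ih =>
    obtain ⟨I, G', i, p, hG', hI, h⟩ := hC.right hG
    exact h.subsingleton_ext_covariant₁ E _ (ih hG') (Ext.subsingleton_of_injective E I _)

/-- Objects of finite injective dimension are left orthogonal to the Gorenstein injectives, by
dimension shifting along an injective coresolution. -/
theorem subsingleton_ext_gorensteinInjective_of_hasInjectiveDimensionLT [EnoughInjectives C]
    {A G : C} (d : ℕ) (hA : HasInjectiveDimensionLT A d) (hG : gorensteinInjective C G) (n : ℕ) :
    Subsingleton (Ext A G (n + 1)) := by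
  have main (d : ℕ) : ∀ (A : C), HasInjectiveDimensionLT A (d + 1) →
      ∀ n : ℕ, Subsingleton (Ext A G (n + 1)) := by
    induction d with
    | zero =>
      intro A hA n
      rw [zero_add, ← injective_iff_hasInjectiveDimensionLT_one] at hA
      exact subsingleton_ext_injective_gorensteinInjective hG n
    | succ d ih =>
      intro A hA n
      have h := IsSES.of_mono (Injective.ι A)
      have hd := (h.shortExact.hasInjectiveDimensionLT_X₃_iff d inferInstance).2 hA
      exact h.subsingleton_ext_contravariant₁ G _
        (subsingleton_ext_injective_gorensteinInjective hG n) (ih _ hd (n + 1))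
  exact main d A (hasInjectiveDimensionLT_of_ge _ _ _ (Nat.le_succ d)) n

/-- Objects of finite projective dimension are left orthogonal to the Gorenstein injectives, because
a Gorenstein injective object is an arbitrarily high cosyzygy of another one. -/
theorem subsingleton_ext_gorensteinInjective_of_hasProjectiveDimensionLT
    {A G : C} (d : ℕ) (hA : HasProjectiveDimensionLT A d) (hG : gorensteinInjective C G) (n : ℕ) :
    Subsingleton (Ext A G (n + 1)) := by
  have hC := isGorensteinCoinductive_gorensteinInjective C
  -- Descending induction on the degree of `Ext`, over all Gorenstein injective objects at once.
  have main (k : ℕ) : ∀ (G : C), gorensteinInjective C G → ∀ n, d ≤ n + 1 + k →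
      Subsingleton (Ext A G (n + 1)) := by
    induction k with
    | zero => intro G hG n hn; exact hA.subsingleton _ _ (n + 1) hn G
    | succ k ih =>
      intro G hG n hn
      obtain ⟨G', I, i, p, hG', hI, h⟩ := hC.left hG
      exact h.subsingleton_ext_covariant₃ A _ (Ext.subsingleton_of_injective A I _)
        (ih G' hG' (n + 1) (by lia))
  exact main d G hG n (by lia)

/-- Gorenstein injective objects are closed under extensions, since the horseshoe lemma shows that
their extensions form a coinductive class. -/
theorem IsSES.gorensteinInjective_middle {A B D : C} {f : A ⟶ B} {g : B ⟶ D} (h : IsSES f g)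
    (hA : gorensteinInjective C A) (hD : gorensteinInjective C D) : gorensteinInjective C B := by
  have hC := isGorensteinCoinductive_gorensteinInjective C
  let P : ObjectProperty C := fun B => ∃ (A D : C) (f : A ⟶ B) (g : B ⟶ D),
    gorensteinInjective C A ∧ gorensteinInjective C D ∧ IsSES f g
  have hP : IsGorensteinCoinductive P := by
    refine ⟨?_, ?_, ?_⟩
    · rintro B ⟨A, D, f, g, hA, hD, h⟩ E hE
      exact h.subsingleton_ext_covariant₂ E 1 (hC.ext hA E) (hC.ext hD E)
    · rintro B ⟨A, D, f, g, hA, hD, h⟩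
      obtain ⟨A', I', i', p', hA', hI', h'⟩ := hC.left hA
      obtain ⟨D', I'', i'', p'', hD', hI'', h''⟩ := hC.left hD
      obtain ⟨e, he⟩ := h.exists_lift_of_ext (hC.ext hA I'') p''
      obtain ⟨V, Q, a, b, i, p, c, d, hab, hip, hcd⟩ :=
        h.op.horseshoe h''.op h'.op e.op (by rw [← op_comp, he])
      exact ⟨_, _, _, _, ⟨_, _, _, _, hA', hD', hcd.unop⟩, hab.unop.injective_middle, hip.unop⟩
    · rintro B ⟨A, D, f, g, hA, hD, h⟩
      obtain ⟨I', A', i', p', hA', hI', h'⟩ := hC.right hA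
      obtain ⟨I'', D', i'', p'', hD', hI'', h''⟩ := hC.right hD
      have := h.mono
      obtain ⟨V, Q, a, b, i, p, c, d, hab, hip, hcd⟩ :=
        h.horseshoe h' h'' (Injective.factorThru i' f) (by simp)
      exact ⟨_, _, _, _, ⟨_, _, _, _, hA', hD', hcd⟩, hab.injective_middle, hip⟩
  exact hP.le_gorensteinInjective _ ⟨A, D, f, g, hA, hD, h⟩

/-- A Gorenstein injective object `G` that is left orthogonal to the Gorenstein injectives is
injective: an epimorphism from an injective object with Gorenstein injective kernel splits. -/
theorem injective_of_gorensteinInjective_of_leftExtOrthogonal {G : C}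
    (hG : gorensteinInjective C G) (hG' : leftExtOrthogonal (gorensteinInjective C) G) :
    Injective G := by
  obtain ⟨G', I, i, p, hG'', hI, h⟩ :=
    (isGorensteinCoinductive_gorensteinInjective C).left hG
  obtain ⟨s, hs⟩ := h.exists_lift_of_ext (hG' G' hG'') (𝟙 G)
  exact Retract.injective (Y := I) ⟨s, p, hs⟩

end GorensteinInjective

/-! ### Special preenvelopes -/

section SpecialPreenvelopes

variable {C : Type u} [Category.{v} C] [Abelian C] [HasExt.{w} C] {P : ObjectProperty C}

theorem IsSES.leftExtOrthogonal_middle {A B D : C} {f : A ⟶ B} {g : B ⟶ D} (h : IsSES f g)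
    (hA : leftExtOrthogonal P A) (hD : leftExtOrthogonal P D) : leftExtOrthogonal P B :=
  fun Y hY => h.subsingleton_ext_contravariant₂ Y 1 (hA Y hY) (hD Y hY)

theorem leftExtOrthogonal_of_iso {A B : C} (e : A ≅ B) (hA : leftExtOrthogonal P A) :
    leftExtOrthogonal P B :=
  fun Y hY => subsingleton_ext_of_iso_left e (hA Y hY)

/-- `X` embeds into an object of `P` with cokernel in `⊥P`. -/
def HasSpecialPreenvelope (P : ObjectProperty C) (X : C) : Prop :=
  ∃ (Y L : C) (f : X ⟶ Y) (g : Y ⟶ L), P Y ∧ leftExtOrthogonal P L ∧ IsSES f g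

theorem isSpecialPreenveloping_iff :
    IsSpecialPreenveloping P ↔ ∀ X, HasSpecialPreenvelope P X := by
  refine ⟨fun h X => ?_, fun h X => ?_⟩
  · obtain ⟨Y, f, hf⟩ := h X
    have := hf.mono
    exact ⟨Y, _, f, _, hf.mem, hf.cokernel_mem, .of_mono f⟩
  · obtain ⟨Y, L, f, g, hY, hL, hS⟩ := h X
    exact ⟨Y, f, hS.mono, hY, leftExtOrthogonal_of_iso
      (IsColimit.coconePointUniqueUpToIso hS.shortExact.gIsCokernel (colimit.isColimit _)) hL⟩

/-- The first step of a special preenvelope may be any monomorphism with cokernel in `⊥P`. -/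
theorem IsSES.hasSpecialPreenvelope {A B L : C} {f : A ⟶ B} {g : B ⟶ L} (h : IsSES f g)
    (hL : leftExtOrthogonal P L) (hB : HasSpecialPreenvelope P B) :
    HasSpecialPreenvelope P A := by
  obtain ⟨Y, L', i, p, hY, hL', h'⟩ := hB
  obtain ⟨Q, q, j, r, hq, hj⟩ := h.comp_left h'
  exact ⟨Y, Q, _, q, hY, hj.leftExtOrthogonal_middle hL hL', hq⟩

end SpecialPreenvelopes

/-! ### Triangular recollements -/

/-- The categorical structure relating modules over a triangular matrix ring to the modules over
its diagonal entries. Think of an object of `𝓛` as a triple `(X, Y, φ : X ⟶ F Y)` with `X` in `𝓢`,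
`Y` in `𝓡` and `F = uS ∘ h` left exact. Then `iS X = (X, 0)`, `iR Y = (0, Y)`, `uS` and `uR` are the
two components, `h Y = (F Y, Y, 𝟙)`, and `k (X, Y, φ) = ker φ`. -/
structure TriangularRecollement (𝓛 𝓢 𝓡 : Type*) [Category* 𝓛] [Abelian 𝓛] [Category* 𝓢] [Abelian 𝓢]
    [Category* 𝓡] [Abelian 𝓡] where
  iS : 𝓢 ⥤ 𝓛
  iR : 𝓡 ⥤ 𝓛
  uS : 𝓛 ⥤ 𝓢
  uR : 𝓛 ⥤ 𝓡
  h : 𝓡 ⥤ 𝓛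
  k : 𝓛 ⥤ 𝓢
  adjR : iR ⊣ uR
  adjH : uR ⊣ h
  adjS : uS ⊣ iS
  adjK : iS ⊣ k
  iR_mono : iR.PreservesMonomorphisms
  uS_mono : uS.PreservesMonomorphisms
  iS_full : iS.Full
  iS_faithful : iS.Faithful
  iR_full : iR.Full
  iR_faithful : iR.Faithful
  h_full : h.Full
  h_faithful : h.Faithful
  isZero_uR_iS (X : 𝓢) : IsZero (uR.obj (iS.obj X))
  isSES_components (N : 𝓛) : IsSES (adjR.counit.app N) (adjS.unit.app N)
  mono_counit (N : 𝓛) : Mono (adjK.counit.app N)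
  counit_unit (N : 𝓛) : adjK.counit.app N ≫ adjH.unit.app N = 0
  exists_lift {N T : 𝓛} (t : T ⟶ N) (ht : t ≫ adjH.unit.app N = 0) :
    ∃ s : T ⟶ iS.obj (k.obj N), s ≫ adjK.counit.app N = t
  epi_unit_of_injective (N : 𝓛) [Injective N] : Epi (adjH.unit.app N)

namespace TriangularRecollement

variable {𝓛 𝓢 𝓡 : Type*} [Category* 𝓛] [Abelian 𝓛] [Category* 𝓢] [Abelian 𝓢]
  [Category* 𝓡] [Abelian 𝓡] (e : TriangularRecollement 𝓛 𝓢 𝓡)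

attribute [instance] iR_mono uS_mono iS_full iS_faithful iR_full iR_faithful h_full h_faithful
  mono_counit

instance : PreservesFiniteLimits e.uR :=
  have := e.adjR.rightAdjoint_preservesLimits
  inferInstance

instance : PreservesFiniteColimits e.uR :=
  have := e.adjH.leftAdjoint_preservesColimits
  inferInstance

instance : PreservesFiniteLimits e.iS :=
  have := e.adjS.rightAdjoint_preservesLimits
  inferInstance

instance : PreservesFiniteColimits e.iS :=
  have := e.adjK.leftAdjoint_preservesColimits
  inferInstance

instance : PreservesFiniteColimits e.uS :=
  have := e.adjS.leftAdjoint_preservesColimits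
  inferInstance

instance : PreservesFiniteColimits e.iR :=
  have := e.adjR.leftAdjoint_preservesColimits
  inferInstance

instance : PreservesFiniteLimits e.h :=
  have := e.adjH.rightAdjoint_preservesLimits
  inferInstance

instance : PreservesFiniteLimits e.k :=
  have := e.adjK.rightAdjoint_preservesLimits
  inferInstance

instance (E : 𝓛) [Injective E] : Injective (e.uR.obj E) := Injective.injective_of_adjoint e.adjR E

instance (E : 𝓢) [Injective E] : Injective (e.iS.obj E) := Injective.injective_of_adjoint e.adjS E

instance (E : 𝓡) [Injective E] : Injective (e.h.obj E) := Injective.injective_of_adjoint e.adjH E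

instance (E : 𝓛) [Injective E] : Injective (e.k.obj E) := Injective.injective_of_adjoint e.adjK E

theorem isSES_k (N : 𝓛) [Epi (e.adjH.unit.app N)] :
    IsSES (e.adjK.counit.app N) (e.adjH.unit.app N) :=
  .of_kernel (e.counit_unit N) e.exists_lift

/-- The functor `k` is exact on short exact sequences whose first term is an epimorphic triple;
this is part of the snake lemma for the natural transformation `𝟭 ⟶ h ∘ uR`. -/
theorem isSES_map_k {A B D : 𝓛} {f : A ⟶ B} {g : B ⟶ D} (hS : IsSES f g)
    [Epi (e.adjH.unit.app A)] : IsSES (e.k.map f) (e.k.map g) := by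
  have := hS.epi
  have hS' := (hS.map e.uR)
  suffices Epi (e.iS.map (e.k.map g)) by
    have := e.iS.epi_of_epi_map this
    exact hS.map_of_epi e.k
  rw [epi_iff_surjective_up_to_refinements]
  intro T t
  obtain ⟨T₁, π₁, hπ₁, b, hb⟩ :=
    surjective_up_to_refinements_of_epi g (t ≫ e.adjK.counit.app D)
  have hb' : (b ≫ e.adjH.unit.app B) ≫ e.h.map (e.uR.map g) = 0 := by
    have := e.adjH.unit.naturality g
    dsimp at this
    rw [Category.assoc, ← this, ← reassoc_of% hb, e.counit_unit]
    simp
  have := hS'.mono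
  have hexact : ((ShortComplex.mk _ _ hS'.w).map e.h).Exact :=
    hS'.shortExact.exact.map_of_mono_of_preservesKernel e.h this inferInstance
  have : Mono ((ShortComplex.mk _ _ hS'.w).map e.h).f :=
    (show Mono (e.h.map (e.uR.map f)) from inferInstance)
  obtain ⟨a, ha⟩ : ∃ a, a ≫ e.h.map (e.uR.map f) = b ≫ e.adjH.unit.app B :=
    ⟨hexact.lift _ hb', hexact.lift_f _ hb'⟩
  obtain ⟨T₂, π₂, hπ₂, c, hc⟩ := surjective_up_to_refinements_of_epi (e.adjH.unit.app A) a
  obtain ⟨s, hs⟩ := e.exists_lift (π₂ ≫ b - c ≫ f) (by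
    have := e.adjH.unit.naturality f
    dsimp at this
    rw [Preadditive.sub_comp, Category.assoc, Category.assoc, this, ← ha, ← reassoc_of% hc,
      sub_self])
  refine ⟨T₂, π₂ ≫ π₁, inferInstance, s, ?_⟩
  rw [← cancel_mono (e.adjK.counit.app D)]
  have := e.adjK.counit.naturality g
  dsimp at this
  simp only [Category.assoc]
  rw [this, reassoc_of% hs, Preadditive.sub_comp, Category.assoc, Category.assoc, hS.w, comp_zero,
    sub_zero, hb]

section Ext

theorem subsingleton_ext_iR_iff [HasExt.{w} 𝓛] [HasExt.{w} 𝓡] [EnoughInjectives 𝓛]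
    (Y : 𝓡) (N : 𝓛) :
    Subsingleton (Ext (e.iR.obj Y) N 1) ↔ Subsingleton (Ext Y (e.uR.obj N) 1) :=
  have hS := IsSES.of_mono (Injective.ι N)
  hS.subsingleton_ext_one_adjunction e.adjR (hS.map e.uR) Y

theorem subsingleton_ext_uS_iff [HasExt.{w} 𝓛] [HasExt.{w} 𝓢] [EnoughInjectives 𝓢]
    (N : 𝓛) (X : 𝓢) :
    Subsingleton (Ext (e.uS.obj N) X 1) ↔ Subsingleton (Ext N (e.iS.obj X) 1) :=
  have hS := IsSES.of_mono (Injective.ι X)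
  hS.subsingleton_ext_one_adjunction e.adjS (hS.map e.iS) N

theorem subsingleton_ext_iS_iff [HasExt.{w} 𝓛] [HasExt.{w} 𝓢] [EnoughInjectives 𝓛]
    (X : 𝓢) (N : 𝓛)
    [Epi (e.adjH.unit.app N)] :
    Subsingleton (Ext (e.iS.obj X) N 1) ↔ Subsingleton (Ext X (e.k.obj N) 1) :=
  have hS := IsSES.of_mono (Injective.ι N)
  hS.subsingleton_ext_one_adjunction e.adjK (e.isSES_map_k hS) X

end Ext

theorem hasInjectiveDimensionLT_iS [EnoughInjectives 𝓢] (d : ℕ) {X : 𝓢}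
    (hX : HasInjectiveDimensionLT X d) : HasInjectiveDimensionLT (e.iS.obj X) (d + 1) := by
  have hX' := hasInjectiveDimensionLT_of_ge X d (d + 1) (Nat.le_succ d)
  clear hX
  induction d generalizing X with
  | zero =>
    rw [zero_add, ← injective_iff_hasInjectiveDimensionLT_one] at hX' ⊢
    infer_instance
  | succ d ih =>
    have hS := IsSES.of_mono (Injective.ι X)
    have hd := (hS.shortExact.hasInjectiveDimensionLT_X₃_iff d inferInstance).2 hX'
    exact ((hS.map e.iS).shortExact.hasInjectiveDimensionLT_X₃_iff d
      (inferInstanceAs (Injective (e.iS.obj _)))).1 (ih hd)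

/-- The two finiteness conditions under which Gorenstein injective objects of `𝓛` are determined
by those of `𝓢` and `𝓡`. With `F = uS ∘ h`, they say that `F` is exact on short exact sequences
starting in a Gorenstein injective object, and that `F` maps injective objects to objects of finite
injective dimension. -/
structure IsCompatible : Prop where
  epi_map_h {A B D : 𝓡} {f : A ⟶ B} {g : B ⟶ D} (hS : IsSES f g)
    (hA : gorensteinInjective 𝓡 A) : Epi (e.h.map g)
  exists_injectiveDimension (E : 𝓡) [Injective E] :
    ∃ d, HasInjectiveDimensionLT (e.uS.obj (e.h.obj E)) d

namespace IsCompatible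

variable {e} (he : e.IsCompatible)

include he

theorem isSES_map_h {A B D : 𝓡} {f : A ⟶ B} {g : B ⟶ D} (hS : IsSES f g)
    (hA : gorensteinInjective 𝓡 A) : IsSES (e.h.map f) (e.h.map g) :=
  have := he.epi_map_h hS hA
  hS.map_of_epi e.h

variable [HasExt.{w} 𝓛] [HasExt.{w} 𝓢] [HasExt.{w} 𝓡]

omit [HasExt.{w} 𝓢] in
theorem subsingleton_ext_uR_iff (N : 𝓛) {G : 𝓡} (hG : gorensteinInjective 𝓡 G) :
    Subsingleton (Ext (e.uR.obj N) G 1) ↔ Subsingleton (Ext N (e.h.obj G) 1) := by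
  obtain ⟨I, G', i, p, hG', hI, hS⟩ :=
    (isGorensteinCoinductive_gorensteinInjective 𝓡).right hG
  exact hS.subsingleton_ext_one_adjunction e.adjH (he.isSES_map_h hS hG) N

omit [HasExt.{w} 𝓢] in
theorem gorensteinInjective_h {G : 𝓡} (hG : gorensteinInjective 𝓡 G) :
    gorensteinInjective 𝓛 (e.h.obj G) := by
  have hC := isGorensteinCoinductive_gorensteinInjective 𝓡
  let P : ObjectProperty 𝓛 := fun N => ∃ G, gorensteinInjective 𝓡 G ∧ e.h.obj G = N
  have hP : IsGorensteinCoinductive P := by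
    refine ⟨?_, ?_, ?_⟩
    · rintro _ ⟨G, hG, rfl⟩ E hE
      exact (he.subsingleton_ext_uR_iff E hG).1 (hC.ext hG _)
    · rintro _ ⟨G, hG, rfl⟩
      obtain ⟨G', I, i, p, hG', hI, hS⟩ := hC.left hG
      exact ⟨_, _, _, _, ⟨G', hG', rfl⟩, inferInstance, he.isSES_map_h hS hG'⟩
    · rintro _ ⟨G, hG, rfl⟩
      obtain ⟨I, G', i, p, hG', hI, hS⟩ := hC.right hG
      exact ⟨_, _, _, _, ⟨G', hG', rfl⟩, inferInstance, he.isSES_map_h hS hG⟩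
  exact hP.le_gorensteinInjective _ ⟨G, hG, rfl⟩

omit [HasExt.{w} 𝓢] in
theorem leftExtOrthogonal_uR {N : 𝓛} (hN : leftExtOrthogonal (gorensteinInjective 𝓛) N) :
    leftExtOrthogonal (gorensteinInjective 𝓡) (e.uR.obj N) := fun _ hG =>
  (he.subsingleton_ext_uR_iff N hG).2 (hN _ (he.gorensteinInjective_h hG))

variable [EnoughInjectives 𝓛] [EnoughInjectives 𝓢]

omit [HasExt.{w} 𝓡] [EnoughInjectives 𝓛] in
theorem gorensteinInjective_iS {G : 𝓢} (hG : gorensteinInjective 𝓢 G) :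
    gorensteinInjective 𝓛 (e.iS.obj G) := by
  have hC := isGorensteinCoinductive_gorensteinInjective 𝓢
  let P : ObjectProperty 𝓛 := fun N => ∃ G, gorensteinInjective 𝓢 G ∧ e.iS.obj G = N
  have hP : IsGorensteinCoinductive P := by
    refine ⟨?_, ?_, ?_⟩
    · rintro _ ⟨G, hG, rfl⟩ E hE
      have := e.epi_unit_of_injective E
      have hu : IsIso (e.adjS.counit.app (e.k.obj E)) := inferInstance
      have hS := (e.isSES_k E).map_of_mono e.uS
      obtain ⟨d, hd⟩ := he.exists_injectiveDimension (e.uR.obj E)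
      have hd' := hasInjectiveDimensionLT_of_ge (e.uS.obj (e.h.obj (e.uR.obj E))) d (d + 1)
        (Nat.le_succ d)
      have hk : HasInjectiveDimensionLT (e.uS.obj (e.iS.obj (e.k.obj E))) 1 :=
        hasInjectiveDimensionLT_of_iso (X := e.k.obj E)
          (asIso (e.adjS.counit.app (e.k.obj E))).symm 1
      have hk' := hasInjectiveDimensionLT_of_ge (e.uS.obj (e.iS.obj (e.k.obj E))) 1 (d + 1)
        (Nat.le_add_left 1 d)
      exact (e.subsingleton_ext_uS_iff E G).1
        (subsingleton_ext_gorensteinInjective_of_hasInjectiveDimensionLT (d + 1)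
          (hS.shortExact.hasInjectiveDimensionLT_X₂ (d + 1) hk' hd') hG 0)
    · rintro _ ⟨G, hG, rfl⟩
      obtain ⟨G', I, i, p, hG', hI, hS⟩ := hC.left hG
      exact ⟨_, _, _, _, ⟨G', hG', rfl⟩, inferInstance, hS.map e.iS⟩
    · rintro _ ⟨G, hG, rfl⟩
      obtain ⟨I, G', i, p, hG', hI, hS⟩ := hC.right hG
      exact ⟨_, _, _, _, ⟨G', hG', rfl⟩, inferInstance, hS.map e.iS⟩
  exact hP.le_gorensteinInjective _ ⟨G, hG, rfl⟩

omit [HasExt.{w} 𝓢] in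
/-- The component in `𝓡` of a Gorenstein injective object is Gorenstein injective. -/
theorem gorensteinInjective_uR {N : 𝓛} (hN : gorensteinInjective 𝓛 N) :
    gorensteinInjective 𝓡 (e.uR.obj N) := by
  have hC := isGorensteinCoinductive_gorensteinInjective 𝓛
  let P : ObjectProperty 𝓡 := fun Y => ∃ N, gorensteinInjective 𝓛 N ∧ e.uR.obj N = Y
  have hP : IsGorensteinCoinductive P := by
    refine ⟨?_, ?_, ?_⟩
    · rintro _ ⟨N, hN, rfl⟩ E hE
      rw [← e.subsingleton_ext_iR_iff]
      obtain ⟨d, hd⟩ := he.exists_injectiveDimension E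
      -- `iR E` embeds into the injective object `h E`, with cokernel of finite injective dimension.
      have hS := (e.isSES_components (e.h.obj E)).subsingleton_ext_contravariant₁ N 1
        (subsingleton_ext_injective_gorensteinInjective hN 0)
        (subsingleton_ext_gorensteinInjective_of_hasInjectiveDimensionLT _
          (e.hasInjectiveDimensionLT_iS d hd) hN 1)
      exact subsingleton_ext_of_iso_left (e.iR.mapIso (asIso (e.adjH.counit.app E))) hS
    · rintro _ ⟨N, hN, rfl⟩
      obtain ⟨N', I, i, p, hN', hI, hS⟩ := hC.left hN
      exact ⟨_, _, _, _, ⟨N', hN', rfl⟩, inferInstance, hS.map e.uR⟩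
    · rintro _ ⟨N, hN, rfl⟩
      obtain ⟨I, N', i, p, hN', hI, hS⟩ := hC.right hN
      exact ⟨_, _, _, _, ⟨N', hN', rfl⟩, inferInstance, hS.map e.uR⟩
  exact hP.le_gorensteinInjective _ ⟨N, hN, rfl⟩

omit [HasExt.{w} 𝓢] in
theorem epi_unit {N : 𝓛} (hN : gorensteinInjective 𝓛 N) : Epi (e.adjH.unit.app N) := by
  obtain ⟨N', I, i, p, hN', hI, hS⟩ := (isGorensteinCoinductive_gorensteinInjective 𝓛).left hN
  have := he.epi_map_h (hS.map e.uR) (he.gorensteinInjective_uR hN')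
  have := e.epi_unit_of_injective I
  have hn := e.adjH.unit.naturality p
  dsimp at hn
  have : Epi (p ≫ e.adjH.unit.app N) := by rw [hn]; infer_instance
  exact epi_of_epi p _

theorem gorensteinInjective_k {N : 𝓛} (hN : gorensteinInjective 𝓛 N) :
    gorensteinInjective 𝓢 (e.k.obj N) := by
  have hC := isGorensteinCoinductive_gorensteinInjective 𝓛
  let P : ObjectProperty 𝓢 := fun X => ∃ N, gorensteinInjective 𝓛 N ∧ e.k.obj N = X
  have hP : IsGorensteinCoinductive P := by
    refine ⟨?_, ?_, ?_⟩
    · rintro _ ⟨N, hN, rfl⟩ E hE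
      have := he.epi_unit hN
      rw [← e.subsingleton_ext_iS_iff]
      exact hC.ext hN _
    · rintro _ ⟨N, hN, rfl⟩
      obtain ⟨N', I, i, p, hN', hI, hS⟩ := hC.left hN
      have := he.epi_unit hN'
      exact ⟨_, _, _, _, ⟨N', hN', rfl⟩, inferInstance, e.isSES_map_k hS⟩
    · rintro _ ⟨N, hN, rfl⟩
      obtain ⟨I, N', i, p, hN', hI, hS⟩ := hC.right hN
      have := he.epi_unit hN
      exact ⟨_, _, _, _, ⟨N', hN', rfl⟩, inferInstance, e.isSES_map_k hS⟩
  exact hP.le_gorensteinInjective _ ⟨N, hN, rfl⟩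

omit [HasExt.{w} 𝓢] in
theorem leftExtOrthogonal_iR {Y : 𝓡} (hY : leftExtOrthogonal (gorensteinInjective 𝓡) Y) :
    leftExtOrthogonal (gorensteinInjective 𝓛) (e.iR.obj Y) := fun N hN =>
  (e.subsingleton_ext_iR_iff Y N).2 (hY _ (he.gorensteinInjective_uR hN))

theorem leftExtOrthogonal_iS {X : 𝓢} (hX : leftExtOrthogonal (gorensteinInjective 𝓢) X) :
    leftExtOrthogonal (gorensteinInjective 𝓛) (e.iS.obj X) := fun N hN =>
  have := he.epi_unit hN
  (e.subsingleton_ext_iS_iff X N).2 (hX _ (he.gorensteinInjective_k hN))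

/-! ### Special preenvelopes in a triangular recollement -/

omit [HasExt.{w} 𝓢] in
theorem hasSpecialPreenvelope_right
    (H : ∀ N, HasSpecialPreenvelope (gorensteinInjective 𝓛) N) (Y : 𝓡) :
    HasSpecialPreenvelope (gorensteinInjective 𝓡) Y := by
  obtain ⟨N, L, f, g, hN, hL, hS⟩ := H (e.iR.obj Y)
  have hu : IsIso (e.adjR.unit.app Y) := inferInstance
  exact ⟨_, _, _, _, he.gorensteinInjective_uR hN, he.leftExtOrthogonal_uR hL,
    (hS.map e.uR).comp_iso_left (asIso (e.adjR.unit.app Y))⟩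

/-- For a special preenvelope `(X, 0) ⟶ N`, the induced map `X ⟶ k N` is a special preenvelope. -/
theorem hasSpecialPreenvelope_left
    (H : ∀ N, HasSpecialPreenvelope (gorensteinInjective 𝓛) N) (X : 𝓢) :
    HasSpecialPreenvelope (gorensteinInjective 𝓢) X := by
  obtain ⟨N, L, f, g, hN, hL, hS⟩ := H (e.iS.obj X)
  have hunit := he.epi_unit hN
  have h0 : IsZero (e.uR.obj (e.iS.obj X)) := e.isZero_uR_iS X
  have h0' : IsZero (e.h.obj (e.uR.obj (e.iS.obj X))) := by
    have := Functor.additive_of_preserves_binary_products e.h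
    exact e.h.map_isZero h0
  have : Epi (e.adjH.unit.app (e.iS.obj X)) := ⟨fun _ _ _ => h0'.eq_of_src _ _⟩
  have hiso : IsIso (e.uR.map g) := (hS.map e.uR).shortExact.isIso_g_iff.2 h0
  have : Epi (e.adjH.unit.app L) := by
    have := hS.epi
    have hn := e.adjH.unit.naturality g
    dsimp at hn
    have : Epi (g ≫ e.adjH.unit.app L) := by rw [hn]; infer_instance
    exact epi_of_epi g _
  -- `uR L ≅ uR N` is both Gorenstein injective and left orthogonal, so it is injective.
  have hinj : Injective (e.uR.obj L) :=
    injective_of_gorensteinInjective_of_leftExtOrthogonal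
      (gorensteinInjective_of_iso (asIso (e.uR.map g)) (he.gorensteinInjective_uR hN))
      (he.leftExtOrthogonal_uR hL)
  have hinj' : Injective ((e.uR ⋙ e.h).obj L) :=
    inferInstanceAs (Injective (e.h.obj (e.uR.obj L)))
  refine ⟨_, _, _, _, he.gorensteinInjective_k hN, fun G hG => ?_,
    (e.isSES_map_k hS).comp_iso_left (asIso (e.adjK.unit.app X))⟩
  have hG' := he.gorensteinInjective_iS hG
  have := he.epi_unit hG'
  refine subsingleton_ext_of_iso_right (asIso (e.adjK.unit.app G)).symm ?_
  refine (e.subsingleton_ext_iS_iff (e.k.obj L) (e.iS.obj G)).1 ?_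
  exact (e.isSES_k L).subsingleton_ext_contravariant₁ _ 1 (hL _ hG')
    (subsingleton_ext_injective_gorensteinInjective hG' 1)

section

variable (HS : ∀ X, HasSpecialPreenvelope (gorensteinInjective 𝓢) X)

include HS

/-- An object `(X, Y, φ)` with `φ` epimorphic and `Y` Gorenstein injective has a special
preenvelope: push out along a special preenvelope of `ker φ`. -/
theorem hasSpecialPreenvelope_of_epi_unit (N : 𝓛) [Epi (e.adjH.unit.app N)]
    (hN : gorensteinInjective 𝓡 (e.uR.obj N)) :
    HasSpecialPreenvelope (gorensteinInjective 𝓛) N := by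
  obtain ⟨K, L, f, g, hK, hL, hS⟩ := HS (e.k.obj N)
  obtain ⟨W, a, b, c, hp, -, hW⟩ := (e.isSES_k N).exists_pushout (e.iS.map f)
  obtain ⟨q, -, hq⟩ := (hS.map e.iS).of_isPushout hp
  exact ⟨W, _, b, q, hW.gorensteinInjective_middle (he.gorensteinInjective_iS hK)
    (he.gorensteinInjective_h hN), he.leftExtOrthogonal_iS hL, hq⟩

/-- An object `(X, Y, φ)` with `Y` Gorenstein injective has a special preenvelope: adding a
projective summand to `X` makes `φ` an epimorphism. -/
theorem hasSpecialPreenvelope_of_gorensteinInjective_uR [EnoughProjectives 𝓛] (N : 𝓛)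
    (hN : gorensteinInjective 𝓡 (e.uR.obj N)) :
    HasSpecialPreenvelope (gorensteinInjective 𝓛) N := by
  let π := Projective.π (e.h.obj (e.uR.obj N))
  obtain ⟨θ, hθ⟩ := (e.adjH.homEquiv _ _).surjective π
  rw [Adjunction.homEquiv_unit] at hθ
  obtain ⟨W, i, b, r, hp, -, hW⟩ := (e.isSES_components (Projective.over _)).exists_pushout
    (e.iR.map θ ≫ e.adjR.counit.app N)
  have hiso : IsIso (e.uR.map i) := (hW.map e.uR).shortExact.isIso_f_iff.2 (e.isZero_uR_iS _)
  have hm := (e.isSES_components W).mono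
  have hb : e.uR.map b = θ ≫ e.uR.map i := by
    apply e.iR.map_injective
    rw [← cancel_mono (e.adjR.counit.app W)]
    have h1 := e.adjR.counit.naturality b
    have h2 := e.adjR.counit.naturality i
    dsimp at h1 h2
    rw [h1, hp.w, Functor.map_comp, Category.assoc, Category.assoc, h2]
  have : Epi (e.adjH.unit.app W) := by
    have h1 : b ≫ e.adjH.unit.app W = π ≫ e.h.map (e.uR.map i) := by
      have := e.adjH.unit.naturality b
      dsimp at this
      rw [this, hb, Functor.map_comp, ← hθ, Category.assoc]
    exact epi_of_epi_fac h1
  have hproj : Projective (e.uS.obj (Projective.over (e.h.obj (e.uR.obj N)))) :=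
    e.adjS.map_projective _ inferInstance
  exact hW.hasSpecialPreenvelope
    (he.leftExtOrthogonal_iS fun X _ => Ext.subsingleton_of_projective _ X 0)
    (he.hasSpecialPreenvelope_of_epi_unit HS W
      (gorensteinInjective_of_iso (asIso (e.uR.map i)) hN))

end

/-- An arbitrary object `(X, Y, φ)` embeds into one with Gorenstein injective `𝓡`-component, by
pushing out along a special preenvelope of `Y`. -/
theorem hasSpecialPreenvelope [EnoughProjectives 𝓛]
    (HS : ∀ X, HasSpecialPreenvelope (gorensteinInjective 𝓢) X)
    (HR : ∀ Y, HasSpecialPreenvelope (gorensteinInjective 𝓡) Y) (N : 𝓛) :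
    HasSpecialPreenvelope (gorensteinInjective 𝓛) N := by
  obtain ⟨Y, L, f, g, hY, hL, hS⟩ := HR (e.uR.obj N)
  obtain ⟨W, i, b, r, hp, -, hW⟩ := (e.isSES_components N).exists_pushout (e.iR.map f)
  have := hS.mono
  obtain ⟨q, -, hq⟩ := (hS.map_of_mono e.iR).of_isPushout hp
  have hiso : IsIso (e.uR.map i) := (hW.map e.uR).shortExact.isIso_f_iff.2 (e.isZero_uR_iS _)
  exact hq.hasSpecialPreenvelope (he.leftExtOrthogonal_iR hL)
    (he.hasSpecialPreenvelope_of_gorensteinInjective_uR HS W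
      (gorensteinInjective_of_iso (asIso (e.adjR.unit.app Y) ≪≫ asIso (e.uR.map i)) hY))

theorem isSpecialPreenveloping_iff [EnoughProjectives 𝓛] :
    IsSpecialPreenveloping (gorensteinInjective 𝓛) ↔
      IsSpecialPreenveloping (gorensteinInjective 𝓡) ∧
        IsSpecialPreenveloping (gorensteinInjective 𝓢) := by
  simp only [_root_.isSpecialPreenveloping_iff]
  exact ⟨fun H => ⟨he.hasSpecialPreenvelope_right H, he.hasSpecialPreenvelope_left H⟩,
    fun H N => he.hasSpecialPreenvelope H.2 H.1 N⟩

end IsCompatible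

end TriangularRecollement

/-! ### Corners of a ring -/

section Corner

variable {A Λ : Type u} [Ring A] [Ring Λ] (ι : A →ₙ+* Λ)

/-- For a possibly non-unital embedding `ι` of a ring `A` into `Λ`, the part `e N` of a `Λ`-module
`N` that is fixed by the idempotent `e = ι 1`. -/
def cornerSubgroup (N : Type u) [AddCommGroup N] [Module Λ N] : AddSubgroup N where
  carrier := {n | ι 1 • n = n}
  zero_mem' := smul_zero _
  add_mem' {a b} ha hb := by
    simp only [Set.mem_ofPred_eq] at *
    rw [smul_add, ha, hb]
  neg_mem' {a} ha := by
    simp only [Set.mem_ofPred_eq] at *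
    rw [smul_neg, ha]

theorem mem_cornerSubgroup {N : Type u} [AddCommGroup N] [Module Λ N] {n : N} :
    n ∈ cornerSubgroup ι N ↔ ι 1 • n = n := Iff.rfl

theorem smul_mem_cornerSubgroup {N : Type u} [AddCommGroup N] [Module Λ N] (a : A) (n : N) :
    ι a • n ∈ cornerSubgroup ι N := by
  rw [mem_cornerSubgroup, ← mul_smul, ← map_mul, one_mul]

instance (N : Type u) [AddCommGroup N] [Module Λ N] : Module A (cornerSubgroup ι N) where
  smul a n := ⟨ι a • (n : N), smul_mem_cornerSubgroup ι a _⟩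
  one_smul n := Subtype.ext n.2
  mul_smul a b n := Subtype.ext (by
    change ι (a * b) • (n : N) = ι a • ι b • (n : N)
    rw [map_mul, mul_smul])
  smul_zero a := Subtype.ext (smul_zero (ι a))
  smul_add a m n := Subtype.ext (smul_add (ι a) (m : N) n)
  add_smul a b n := Subtype.ext (by
    change ι (a + b) • (n : N) = ι a • (n : N) + ι b • (n : N)
    rw [map_add, add_smul])
  zero_smul n := Subtype.ext (by
    change ι 0 • (n : N) = 0
    rw [map_zero, zero_smul])

@[simp]
theorem coe_smul_cornerSubgroup {N : Type u} [AddCommGroup N] [Module Λ N] (a : A)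
    (n : cornerSubgroup ι N) : ((a • n : cornerSubgroup ι N) : N) = ι a • (n : N) := rfl

/-- The restriction of a `Λ`-linear map to corners. -/
def cornerMap {N N' : Type u} [AddCommGroup N] [Module Λ N] [AddCommGroup N'] [Module Λ N']
    (f : N →ₗ[Λ] N') : cornerSubgroup ι N →ₗ[A] cornerSubgroup ι N' where
  toFun n := ⟨f n, by rw [mem_cornerSubgroup, ← map_smul, n.2]⟩
  map_add' m n := Subtype.ext (map_add f (m : N) n)
  map_smul' a n := Subtype.ext (map_smul f (ι a) (n : N))

/-- The functor `N ↦ e N` from `Λ`-modules to `A`-modules. -/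
def cornerFunctor : ModuleCat.{u} Λ ⥤ ModuleCat.{u} A where
  obj N := ModuleCat.of A (cornerSubgroup ι N)
  map f := ModuleCat.ofHom (cornerMap ι f.hom)

instance : (cornerFunctor ι).PreservesMonomorphisms where
  preserves f hf := by
    rw [ModuleCat.mono_iff_injective] at hf ⊢
    intro x y hxy
    exact Subtype.ext (hf (congrArg Subtype.val hxy))

end Corner

theorem IsSES.of_exact {A : Type u} [Ring A] {X Y Z : ModuleCat.{u} A} {f : X ⟶ Y} {g : Y ⟶ Z}
    (hf : Function.Injective f) (hg : Function.Surjective g) (h : Function.Exact f g) :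
    IsSES f g :=
  ⟨by ext x; exact h.apply_apply_eq_zero x,
    ModuleCat.shortComplex_shortExact (.mk f g (by ext x; exact h.apply_apply_eq_zero x)) h hf hg⟩

theorem ModuleCat.restrictScalars_full_of_surjective {Λ A : Type u} [Ring Λ] [Ring A]
    (f : Λ →+* A) (hf : Function.Surjective f) : (ModuleCat.restrictScalars.{u} f).Full where
  map_surjective {X Y} g := by
    refine ⟨ModuleCat.ofHom
      { toFun := fun x => g.hom x
        map_add' := fun x y => g.hom.map_add x y
        map_smul' := fun a x => ?_ }, rfl⟩
    obtain ⟨l, rfl⟩ := hf a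
    exact g.hom.map_smul l x

namespace TriangularMatrixRing

variable (S M R : Type u) [Ring S] [Ring R] [AddCommGroup M]
  [Module R M] [Module Sᵐᵒᵖ M] [SMulCommClass R Sᵐᵒᵖ M]

/-- The projection to the upper diagonal entry. -/
@[simps]
def toS : TriangularMatrixRing S M R →+* S where
  toFun := s
  map_one' := rfl
  map_mul' _ _ := rfl
  map_zero' := rfl
  map_add' _ _ := rfl

/-- The projection to the lower diagonal entry. -/
@[simps]
def toR : TriangularMatrixRing S M R →+* R where
  toFun := r
  map_one' := rfl
  map_mul' _ _ := rfl
  map_zero' := rfl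
  map_add' _ _ := rfl

/-- The inclusion of the upper diagonal entry. -/
@[simps]
def ofS : S →ₙ+* TriangularMatrixRing S M R where
  toFun s := ⟨s, 0, 0⟩
  map_mul' _ _ := by ext <;> simp
  map_zero' := rfl
  map_add' _ _ := by ext <;> simp

/-- The inclusion of the lower diagonal entry. -/
@[simps]
def ofR : R →ₙ+* TriangularMatrixRing S M R where
  toFun r := ⟨0, 0, r⟩
  map_mul' _ _ := by ext <;> simp
  map_zero' := rfl
  map_add' _ _ := by ext <;> simp

/-- The inclusion of the off-diagonal entry. -/
@[simps]
def ofM : M →+ TriangularMatrixRing S M R where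
  toFun m := ⟨0, m, 0⟩
  map_zero' := rfl
  map_add' _ _ := by ext <;> simp

variable {S M R}

section Module

variable {N : Type u} [AddCommGroup N] [Module (TriangularMatrixRing S M R) N]

theorem ofS_one_add_ofR_one : ofS S M R 1 + ofR S M R 1 = 1 := by ext <;> simp

theorem mul_ofR_one (a : TriangularMatrixRing S M R) : a * ofR S M R 1 = ofR S M R a.r := by
  ext <;> simp

theorem ofS_one_mul (a : TriangularMatrixRing S M R) : ofS S M R 1 * a = ofS S M R a.s := by
  ext <;> simp

theorem ofS_mul_ofS_one (s : S) : ofS S M R s * ofS S M R 1 = ofS S M R s := by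
  ext <;> simp

theorem ofR_mul_ofM (r : R) (m : M) : ofR S M R r * ofM S M R m = ofM S M R (r • m) := by
  ext <;> simp

theorem ofM_mul (a : TriangularMatrixRing S M R) (m : M) :
    ofM S M R m * a = ofM S M R (MulOpposite.op a.s • m) := by
  ext <;> simp

theorem ofR_one_mul (a : TriangularMatrixRing S M R) :
    ofR S M R 1 * a = ofM S M R a.m + ofR S M R a.r := by
  ext <;> simp

theorem smul_of_mem_cornerR (a : TriangularMatrixRing S M R)
    {n : N} (hn : n ∈ cornerSubgroup (ofR S M R) N) : a • n = ofR S M R a.r • n := by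
  rw [← mul_ofR_one, mul_smul, (mem_cornerSubgroup _).1 hn]

theorem ofM_smul_mem (m : M) (n : N) : ofM S M R m • n ∈ cornerSubgroup (ofR S M R) N := by
  rw [mem_cornerSubgroup, ← mul_smul, ofR_mul_ofM, one_smul]

variable (S M R N) in
/-- The kernel of the structure map `X → Hom(M, Y)` of a `Λ`-module `(X, Y)`: the elements that
are annihilated by all matrices whose upper diagonal entry vanishes. -/
def kerSubgroup : AddSubgroup N where
  carrier := {n | ∀ a : TriangularMatrixRing S M R, a.s = 0 → a • n = 0}
  zero_mem' _ _ := smul_zero _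
  add_mem' {x y} hx hy a ha := by rw [smul_add, hx a ha, hy a ha, add_zero]
  neg_mem' {x} hx a ha := by rw [smul_neg, hx a ha, neg_zero]

theorem smul_of_mem_kerSubgroup (a : TriangularMatrixRing S M R) {n : N}
    (hn : n ∈ kerSubgroup S M R N) : a • n = ofS S M R a.s • n := by
  rw [← sub_eq_zero, ← sub_smul]
  refine hn _ ?_
  rw [sub_eq_add_neg]
  simp

theorem mem_kerSubgroup_iff {n : N} :
    n ∈ kerSubgroup S M R N ↔ ofR S M R 1 • n = 0 ∧ ∀ m, ofM S M R m • n = 0 := by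
  refine ⟨fun h => ⟨h _ rfl, fun m => h _ rfl⟩, fun h a ha => ?_⟩
  have : a = ofM S M R a.m + a * ofR S M R 1 := by ext <;> simp [ha]
  rw [this, add_smul, mul_smul, h.1, h.2, smul_zero, add_zero]

theorem smul_mem_kerSubgroup (a : TriangularMatrixRing S M R) {n : N}
    (hn : n ∈ kerSubgroup S M R N) : a • n ∈ kerSubgroup S M R N := by
  intro b hb
  rw [← mul_smul]
  exact hn _ (by simp [hb])

instance : Module S (kerSubgroup S M R N) where
  smul a n := ⟨ofS S M R a • (n : N), smul_mem_kerSubgroup _ n.2⟩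
  one_smul n := Subtype.ext (by
    change ofS S M R 1 • (n : N) = n
    rw [← one_s (S := S) (M := M) (R := R), ← smul_of_mem_kerSubgroup _ n.2, one_smul])
  mul_smul a b n := Subtype.ext (by
    change ofS S M R (a * b) • (n : N) = ofS S M R a • ofS S M R b • (n : N)
    rw [map_mul, mul_smul])
  smul_zero a := Subtype.ext (smul_zero (ofS S M R a))
  smul_add a m n := Subtype.ext (smul_add (ofS S M R a) (m : N) n)
  add_smul a b n := Subtype.ext (by
    change ofS S M R (a + b) • (n : N) = ofS S M R a • (n : N) + ofS S M R b • (n : N)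
    rw [map_add, add_smul])
  zero_smul n := Subtype.ext (by
    change ofS S M R 0 • (n : N) = 0
    rw [map_zero, zero_smul])

/-- The restriction of a `Λ`-linear map to the kernels of the structure maps. -/
def kerMap {N' : Type u} [AddCommGroup N'] [Module (TriangularMatrixRing S M R) N']
    (f : N →ₗ[TriangularMatrixRing S M R] N') : kerSubgroup S M R N →ₗ[S] kerSubgroup S M R N' where
  toFun n := ⟨f n, fun a ha => by rw [← map_smul, n.2 a ha, map_zero]⟩
  map_add' m n := Subtype.ext (map_add f (m : N) n)
  map_smul' a n := Subtype.ext (map_smul f (ofS S M R a) (n : N))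

end Module

variable (S M R) in
/-- The functor sending a `Λ`-module to the kernel of its structure map. -/
def kerFunctor : ModuleCat.{u} (TriangularMatrixRing S M R) ⥤ ModuleCat.{u} S where
  obj N := ModuleCat.of S (kerSubgroup S M R N)
  map f := ModuleCat.ofHom (kerMap f.hom)

section Coind

variable (M R) in
/-- The `Λ`-module `(Hom_R(M, Y), Y)`, whose structure map is the identity of `Hom_R(M, Y)`. -/
def Coind (Y : Type u) [AddCommGroup Y] [Module R Y] : Type u := (M →ₗ[R] Y) × Y

namespace Coind

variable {Y : Type u} [AddCommGroup Y] [Module R Y]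

instance : AddCommGroup (Coind M R Y) := inferInstanceAs (AddCommGroup ((M →ₗ[R] Y) × Y))

@[ext]
theorem ext {p q : Coind M R Y} (h₁ : ∀ m, p.1 m = q.1 m) (h₂ : p.2 = q.2) : p = q :=
  Prod.ext (LinearMap.ext h₁) h₂

@[simp] theorem add_fst (p q : Coind M R Y) : (p + q).1 = p.1 + q.1 := rfl
@[simp] theorem add_snd (p q : Coind M R Y) : (p + q).2 = p.2 + q.2 := rfl
@[simp] theorem zero_fst : (0 : Coind M R Y).1 = 0 := rfl
@[simp] theorem zero_snd : (0 : Coind M R Y).2 = 0 := rfl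

instance : SMul (TriangularMatrixRing S M R) (Coind M R Y) where
  smul a p := ⟨{ toFun := fun m => p.1 (MulOpposite.op a.s • m)
                 map_add' := fun m m' => by rw [smul_add, map_add]
                 map_smul' := fun r m => by rw [← smul_comm, map_smul]; rfl },
    p.1 a.m + a.r • p.2⟩

@[simp] theorem smul_fst_apply (a : TriangularMatrixRing S M R) (p : Coind M R Y) (m : M) :
    (a • p).1 m = p.1 (MulOpposite.op a.s • m) := rfl

@[simp] theorem smul_snd (a : TriangularMatrixRing S M R) (p : Coind M R Y) :
    (a • p).2 = p.1 a.m + a.r • p.2 := rfl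

instance : Module (TriangularMatrixRing S M R) (Coind M R Y) where
  one_smul p := by ext <;> simp
  mul_smul a b p := by ext <;> simp [mul_smul, smul_add, add_assoc]
  smul_zero a := by ext <;> simp
  smul_add a p q := by ext <;> simp; abel
  add_smul a b p := by ext <;> simp [add_smul]; abel
  zero_smul p := by ext <;> simp

variable (S) in
/-- The `Λ`-linear map induced by an `R`-linear map. -/
def map {Y' : Type u} [AddCommGroup Y'] [Module R Y'] (f : Y →ₗ[R] Y') :
    Coind M R Y →ₗ[TriangularMatrixRing S M R] Coind M R Y' where
  toFun p := ⟨f ∘ₗ p.1, f p.2⟩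
  map_add' p q := Coind.ext (fun m => map_add f (p.1 m) (q.1 m)) (map_add f p.2 q.2)
  map_smul' a p := Coind.ext (fun _ => rfl) (by
    change f (p.1 a.m + a.r • p.2) = f (p.1 a.m) + a.r • f p.2
    rw [map_add, map_smul])

end Coind

variable (S M R) in
/-- The functor `Y ↦ (Hom_R(M, Y), Y)`. -/
def coindFunctor : ModuleCat.{u} R ⥤ ModuleCat.{u} (TriangularMatrixRing S M R) where
  obj Y := ModuleCat.of _ (Coind M R Y)
  map f := ModuleCat.ofHom (Coind.map S f.hom)

variable (M) in
/-- The map from a `Λ`-module `(X, Y)` to `(Hom_R(M, Y), Y)` given by its structure map. -/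
def toCoind (N : Type u) [AddCommGroup N] [Module (TriangularMatrixRing S M R) N] :
    N →ₗ[TriangularMatrixRing S M R] Coind M R (cornerSubgroup (ofR S M R) N) where
  toFun n := ⟨
    { toFun := fun m => ⟨ofM S M R m • n, ofM_smul_mem m n⟩
      map_add' := fun m m' => Subtype.ext (by
        change ofM S M R (m + m') • n = ofM S M R m • n + ofM S M R m' • n
        rw [map_add, add_smul])
      map_smul' := fun r m => Subtype.ext (by
        change ofM S M R (r • m) • n = ofR S M R r • ofM S M R m • n
        rw [← mul_smul, ofR_mul_ofM]) },
    ⟨ofR S M R 1 • n, smul_mem_cornerSubgroup _ _ _⟩⟩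
  map_add' n n' := by
    ext
    · exact smul_add (ofM S M R _) n n'
    · exact smul_add (ofR S M R 1) n n'
  map_smul' a n := by
    ext m
    · change ofM S M R m • a • n = ofM S M R (MulOpposite.op a.s • m) • n
      rw [← mul_smul, ofM_mul]
    · change ofR S M R 1 • a • n = ofM S M R a.m • n + ofR S M R a.r • ofR S M R 1 • n
      rw [← mul_smul, ofR_one_mul, add_smul, ← mul_smul, ← map_mul, mul_one]

end Coind

/-! ### The recollement of modules over a triangular matrix ring -/

section Adjunctions

variable (S M R)

/-- The inclusion of `(0, Y)` into the `Λ`-module `N = (X, Y)`. -/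
noncomputable def cornerInclusion (N : ModuleCat.{u} (TriangularMatrixRing S M R)) :
    (ModuleCat.restrictScalars (toR S M R)).obj ((cornerFunctor (ofR S M R)).obj N) ⟶ N :=
  ModuleCat.ofHom (X := (ModuleCat.restrictScalars (toR S M R)).obj
    ((cornerFunctor (ofR S M R)).obj N))
    { toFun := fun n : cornerSubgroup (ofR S M R) N => (n : N)
      map_add' := fun _ _ => rfl
      map_smul' := fun a (n : cornerSubgroup (ofR S M R) N) => (smul_of_mem_cornerR a n.2).symm }

/-- The functor `Y ↦ (0, Y)` is left adjoint to `(X, Y) ↦ Y`. -/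
noncomputable def adjR : ModuleCat.restrictScalars.{u} (toR S M R) ⊣ cornerFunctor (ofR S M R) where
  unit :=
    { app Y := ModuleCat.ofHom
        { toFun := fun y : Y => ⟨y, one_smul R y⟩
          map_add' := fun _ _ => rfl
          map_smul' := fun _ _ => rfl }
      naturality _ _ _ := rfl }
  counit :=
    { app := cornerInclusion S M R
      naturality _ _ _ := rfl }
  left_triangle_components _ := rfl
  right_triangle_components _ := rfl

/-- The projection of the `Λ`-module `N = (X, Y)` to `(X, 0)`. -/
noncomputable def cornerProjection (N : ModuleCat.{u} (TriangularMatrixRing S M R)) :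
    N ⟶ (ModuleCat.restrictScalars (toS S M R)).obj ((cornerFunctor (ofS S M R)).obj N) :=
  ModuleCat.ofHom (Y := (ModuleCat.restrictScalars (toS S M R)).obj
    ((cornerFunctor (ofS S M R)).obj N))
    { toFun := fun n : N => (⟨ofS S M R 1 • n, smul_mem_cornerSubgroup _ _ _⟩ :
        cornerSubgroup (ofS S M R) N)
      map_add' := fun m n => Subtype.ext (smul_add (ofS S M R 1) m n)
      map_smul' := fun a n => Subtype.ext (by
        change ofS S M R 1 • a • n = ofS S M R a.s • ofS S M R 1 • n
        rw [← mul_smul, ofS_one_mul, ← mul_smul, ofS_mul_ofS_one]) }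

/-- The functor `X ↦ (X, 0)` is right adjoint to `(X, Y) ↦ X`. -/
noncomputable def adjS : cornerFunctor (ofS S M R) ⊣ ModuleCat.restrictScalars.{u} (toS S M R) where
  unit :=
    { app := cornerProjection S M R
      naturality N N' f := by
        ext n
        exact Subtype.ext (map_smul f.hom (ofS S M R 1) n).symm }
  counit :=
    { app X := ModuleCat.ofHom
        { toFun := fun x => (x.1 : X)
          map_add' := fun _ _ => rfl
          map_smul' := fun _ _ => rfl }
      naturality _ _ _ := rfl }
  left_triangle_components N := by
    ext n
    exact Subtype.ext n.2
  right_triangle_components X := by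
    ext x
    exact one_smul S (x : X)

/-- The functor `Y ↦ (Hom_R(M, Y), Y)` is right adjoint to `(X, Y) ↦ Y`. -/
noncomputable def adjH : cornerFunctor (ofR S M R) ⊣ coindFunctor S M R where
  unit :=
    { app N := ModuleCat.ofHom (toCoind M N)
      naturality N N' f := by
        ext n : 2
        refine Coind.ext (fun m => Subtype.ext ?_) (Subtype.ext ?_)
        · exact (map_smul f.hom (ofM S M R m) n).symm
        · exact (map_smul f.hom (ofR S M R 1) n).symm }
  counit :=
    { app Y := ModuleCat.ofHom
        { toFun := fun p : cornerSubgroup (ofR S M R) (Coind M R Y) => p.1.2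
          map_add' := fun _ _ => rfl
          map_smul' := fun r p => by
            change p.1.1 0 + r • p.1.2 = r • p.1.2
            rw [map_zero, zero_add] }
      naturality _ _ _ := rfl }
  left_triangle_components N := by
    ext n
    exact Subtype.ext n.2
  right_triangle_components Y := by
    refine ModuleCat.hom_ext (LinearMap.ext fun (p : Coind M R Y) => Coind.ext (fun m => ?_) ?_)
    · change p.1 m + (0 : R) • p.2 = p.1 m
      rw [zero_smul, add_zero]
    · change p.1 0 + (1 : R) • p.2 = p.2
      rw [map_zero, zero_add, one_smul]

/-- The inclusion of `(ker φ, 0)` into the `Λ`-module `N = (X, Y, φ)`. -/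
noncomputable def kerInclusion (N : ModuleCat.{u} (TriangularMatrixRing S M R)) :
    (ModuleCat.restrictScalars (toS S M R)).obj ((kerFunctor S M R).obj N) ⟶ N :=
  ModuleCat.ofHom (X := (ModuleCat.restrictScalars (toS S M R)).obj
    ((kerFunctor S M R).obj N))
    { toFun := fun n : kerSubgroup S M R N => (n : N)
      map_add' := fun _ _ => rfl
      map_smul' := fun a (n : kerSubgroup S M R N) => (smul_of_mem_kerSubgroup a n.2).symm }

/-- The functor `X ↦ (X, 0)` is left adjoint to `(X, Y, φ) ↦ ker φ`. -/
noncomputable def adjK : ModuleCat.restrictScalars.{u} (toS S M R) ⊣ kerFunctor S M R where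
  unit :=
    { app X := ModuleCat.ofHom
        { toFun := fun x : X => ⟨x, fun a ha => by
            change a.s • x = 0
            rw [ha, zero_smul]⟩
          map_add' := fun _ _ => rfl
          map_smul' := fun _ _ => rfl }
      naturality _ _ _ := rfl }
  counit :=
    { app := kerInclusion S M R
      naturality _ _ _ := rfl }
  left_triangle_components _ := rfl
  right_triangle_components _ := rfl

/-- The structure map of an injective `Λ`-module is surjective. -/
theorem toCoind_surjective_of_injective (N : ModuleCat.{u} (TriangularMatrixRing S M R))
    [Injective N] : Function.Surjective (toCoind (S := S) (R := R) M N) := by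
  rintro ⟨f, y⟩
  have hN : Module.Baer (TriangularMatrixRing S M R) N :=
    Module.Baer.of_injective (Module.injective_module_of_injective_object _ N)
  -- The element `(f, y)` is a linear map on the left ideal of matrices with vanishing upper
  -- diagonal entry; the value at `1` of an extension to `Λ` is a preimage of `(f, y)`.
  let J : Ideal (TriangularMatrixRing S M R) := RingHom.ker (toS S M R)
  let φ : J →ₗ[TriangularMatrixRing S M R] N :=
    { toFun := fun a => (f a.1.m + a.1.r • y : cornerSubgroup (ofR S M R) N)
      map_add' := fun a b => congrArg Subtype.val (show
        f (a.1.m + b.1.m) + (a.1.r + b.1.r) • y = (f a.1.m + a.1.r • y) + (f b.1.m + b.1.r • y) by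
          rw [map_add, add_smul]; abel)
      map_smul' := fun a b => by
        have hb : b.1.s = 0 := b.2
        rw [RingHom.id_apply, smul_of_mem_cornerR a (Subtype.prop _), ← coe_smul_cornerSubgroup]
        refine congrArg Subtype.val ?_
        change f (MulOpposite.op b.1.s • a.m + a.r • b.1.m) + (a.r * b.1.r) • y = _
        rw [hb, MulOpposite.op_zero, zero_smul, zero_add, map_smul, smul_add, mul_smul] }
  obtain ⟨ψ, hψ⟩ := hN J φ
  refine ⟨ψ 1, Coind.ext (fun m => Subtype.ext ?_) (Subtype.ext ?_)⟩
  · change ofM S M R m • ψ 1 = f m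
    have h1 : ofM S M R m ∈ J := rfl
    rw [← map_smul, smul_eq_mul, mul_one, hψ _ h1]
    change ((f m + (0 : R) • y : cornerSubgroup (ofR S M R) N) : N) = f m
    rw [zero_smul, add_zero]
  · change ofR S M R 1 • ψ 1 = y
    have h1 : ofR S M R 1 ∈ J := rfl
    rw [← map_smul, smul_eq_mul, mul_one, hψ _ h1]
    change ((f 0 + (1 : R) • y : cornerSubgroup (ofR S M R) N) : N) = y
    rw [map_zero, one_smul, zero_add]

instance (Y : ModuleCat.{u} R) : IsIso ((adjH S M R).counit.app Y) := by
  rw [ConcreteCategory.isIso_iff_bijective]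
  refine ⟨(injective_iff_map_eq_zero ((adjH S M R).counit.app Y).hom).2 fun p hp => ?_,
    fun (y : Y) => ⟨⟨⟨0, y⟩, Coind.ext (fun _ => rfl) ?_⟩, rfl⟩⟩
  · obtain ⟨p, hp'⟩ := (p : cornerSubgroup (ofR S M R) (Coind M R Y))
    refine Subtype.ext (Coind.ext (fun m => ?_) hp)
    have h1 : p.1 ((0 : Sᵐᵒᵖ) • m) = p.1 m := congrArg (fun q : Coind M R Y => q.1 m) hp'
    change p.1 m = 0
    rw [← h1, zero_smul, map_zero]
  · change (0 : M →ₗ[R] Y) 0 + (1 : R) • y = y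
    rw [LinearMap.zero_apply, zero_add, one_smul]

theorem coindFunctor_full : (coindFunctor S M R).Full := by
  have : IsIso (adjH S M R).counit := NatIso.isIso_of_isIso_app _
  exact (adjH S M R).fullyFaithfulROfIsIsoCounit.full

theorem coindFunctor_faithful : (coindFunctor S M R).Faithful := by
  have : IsIso (adjH S M R).counit := NatIso.isIso_of_isIso_app _
  exact (adjH S M R).fullyFaithfulROfIsIsoCounit.faithful

/-- The `Λ`-module `(X, 0)` has vanishing second component. -/
theorem isZero_cornerFunctor_restrictScalars (X : ModuleCat.{u} S) :
    IsZero ((cornerFunctor (ofR S M R)).obj ((ModuleCat.restrictScalars (toS S M R)).obj X)) := by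
  refine @ModuleCat.isZero_of_subsingleton _ _ _ (subsingleton_of_forall_eq 0 fun x => ?_)
  obtain ⟨x, hx⟩ := (x : cornerSubgroup (ofR S M R) ((ModuleCat.restrictScalars (toS S M R)).obj X))
  refine Subtype.ext ?_
  have h1 : (0 : S) • (x : X) = x := hx
  exact h1.symm.trans (zero_smul S (x : X))

/-- The short exact sequence `0 → (0, Y) → (X, Y) → (X, 0) → 0`. -/
theorem isSES_corners (N : ModuleCat.{u} (TriangularMatrixRing S M R)) :
    IsSES (cornerInclusion S M R N) (cornerProjection S M R N) := by
  refine .of_exact Subtype.val_injective (fun n => ⟨n.1, Subtype.ext n.2⟩) fun n => ?_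
  have h1 : cornerProjection S M R N n = 0 ↔ ofS S M R 1 • n = 0 := Subtype.ext_iff
  rw [h1]
  constructor
  · intro h
    refine ⟨⟨n, ?_⟩, rfl⟩
    rw [mem_cornerSubgroup]
    conv_rhs => rw [← one_smul (TriangularMatrixRing S M R) n, ← ofS_one_add_ofR_one, add_smul, h,
      zero_add]
  · rintro ⟨⟨n, hn⟩, rfl⟩
    exact (smul_of_mem_cornerR _ hn).trans (by
      change ofR S M R 0 • n = 0
      rw [map_zero, zero_smul])

variable {S M R} in
theorem toCoind_eq_zero_iff {N : Type u} [AddCommGroup N] [Module (TriangularMatrixRing S M R) N]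
    (n : N) : toCoind (S := S) (R := R) M N n = 0 ↔ n ∈ kerSubgroup S M R N := by
  rw [mem_kerSubgroup_iff]
  refine ⟨fun h => ⟨congrArg (fun p => (p.2 : N)) h, fun m => congrArg (fun p => (p.1 m : N)) h⟩,
    fun h => Coind.ext (fun m => Subtype.ext (h.2 m)) (Subtype.ext h.1)⟩

/-- Modules over the triangular matrix ring `[[S, 0], [M, R]]` form a triangular recollement of
the modules over `S` and over `R`. -/
noncomputable def recollement : TriangularRecollement (ModuleCat.{u} (TriangularMatrixRing S M R))
    (ModuleCat.{u} S) (ModuleCat.{u} R) where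
  iS := ModuleCat.restrictScalars.{u} (toS S M R)
  iR := ModuleCat.restrictScalars.{u} (toR S M R)
  uS := cornerFunctor (ofS S M R)
  uR := cornerFunctor (ofR S M R)
  h := coindFunctor S M R
  k := kerFunctor S M R
  adjR := adjR S M R
  adjH := adjH S M R
  adjS := adjS S M R
  adjK := adjK S M R
  iR_mono :=
    { preserves := fun f hf => by
        rw [ModuleCat.mono_iff_injective] at hf ⊢
        exact hf }
  uS_mono := inferInstance
  iS_full := ModuleCat.restrictScalars_full_of_surjective _ fun s => ⟨⟨s, 0, 0⟩, rfl⟩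
  iS_faithful := inferInstance
  iR_full := ModuleCat.restrictScalars_full_of_surjective _ fun r => ⟨⟨0, 0, r⟩, rfl⟩
  iR_faithful := inferInstance
  h_full := coindFunctor_full S M R
  h_faithful := coindFunctor_faithful S M R
  isZero_uR_iS := isZero_cornerFunctor_restrictScalars S M R
  isSES_components := isSES_corners S M R
  mono_counit N := by
    rw [ModuleCat.mono_iff_injective]
    exact Subtype.val_injective
  counit_unit N := by
    exact ModuleCat.hom_ext (LinearMap.ext fun n => (toCoind_eq_zero_iff _).2 n.2)
  exists_lift {N T} t ht := by
    have ht' (x : T) : t x ∈ kerSubgroup S M R N :=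
      (toCoind_eq_zero_iff _).1 (congrArg (fun f => f x) ht)
    refine ⟨ModuleCat.ofHom (Y := (ModuleCat.restrictScalars.{u} (toS S M R)).obj
      ((kerFunctor S M R).obj N))
      { toFun := fun x => (⟨t x, ht' x⟩ : kerSubgroup S M R N)
        map_add' := fun x y => Subtype.ext (map_add t.hom x y)
        map_smul' := fun a x => Subtype.ext ?_ }, rfl⟩
    exact (map_smul t.hom a x).trans (smul_of_mem_kerSubgroup a (ht' x))
  epi_unit_of_injective N hN := by
    rw [ModuleCat.epi_iff_surjective]
    exact toCoind_surjective_of_injective S M R N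

end Adjunctions

end TriangularMatrixRing

/-! ### Duals of right modules and flat dimension -/

section RightDual

variable (S : Type u) [Ring S]

/-- The dual `Hom_ℤ(F, D)` of a right `S`-module `F` with values in an abelian group `D`, with the
left `S`-module structure `(s f)(x) = f(x s)`. -/
def RightDual (F D : Type u) [AddCommGroup F] [Module Sᵐᵒᵖ F] [AddCommGroup D] : Type u := F →+ D

namespace RightDual

variable {S} {F D : Type u} [AddCommGroup F] [Module Sᵐᵒᵖ F] [AddCommGroup D]

instance : AddCommGroup (RightDual S F D) := inferInstanceAs (AddCommGroup (F →+ D))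

instance : FunLike (RightDual S F D) F D := inferInstanceAs (FunLike (F →+ D) F D)

instance : AddMonoidHomClass (RightDual S F D) F D :=
  inferInstanceAs (AddMonoidHomClass (F →+ D) F D)

@[ext]
theorem ext {f g : RightDual S F D} (h : ∀ x, f x = g x) : f = g := DFunLike.ext _ _ h

@[simp] theorem add_apply (f g : RightDual S F D) (x : F) : (f + g) x = f x + g x := rfl

@[simp] theorem zero_apply (x : F) : (0 : RightDual S F D) x = 0 := rfl

instance : SMul S (RightDual S F D) where
  smul s f := AddMonoidHom.comp f (DistribSMul.toAddMonoidHom F (MulOpposite.op s))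

@[simp] theorem smul_apply (s : S) (f : RightDual S F D) (x : F) :
    (s • f) x = f (MulOpposite.op s • x) := rfl

instance : Module S (RightDual S F D) where
  one_smul f := by ext; simp
  mul_smul s t f := by ext; simp [mul_smul]
  smul_zero s := by ext; simp
  smul_add s f g := by ext; simp
  add_smul s t f := by ext; simp [add_smul]
  zero_smul f := by ext; simp

variable (D) in
/-- The dual of a linear map of right modules. -/
def map {F' : Type u} [AddCommGroup F'] [Module Sᵐᵒᵖ F'] (p : F →ₗ[Sᵐᵒᵖ] F') :
    RightDual S F' D →ₗ[S] RightDual S F D where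
  toFun f := AddMonoidHom.comp f p.toAddMonoidHom
  map_add' _ _ := rfl
  map_smul' s f := by
    ext x
    exact congrArg f (p.map_smul (MulOpposite.op s) x).symm

@[simp] theorem map_apply {F' : Type u} [AddCommGroup F'] [Module Sᵐᵒᵖ F'] (p : F →ₗ[Sᵐᵒᵖ] F')
    (f : RightDual S F' D) (x : F) : map D p f x = f (p x) := rfl

end RightDual

section

variable {S} {F : Type u} [AddCommGroup F] [Module Sᵐᵒᵖ F] {N D : Type u} [AddCommGroup N]
  [Module S N] [AddCommGroup D]

/-- One direction of the tensor-hom adjunction for balanced tensor products. -/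
def BalancedTensor.lift (f : N →ₗ[S] RightDual S F D) : BalancedTensor S F N →+ D :=
  QuotientAddGroup.lift _
    (TensorProduct.liftAddHom (R := ℤ)
      (AddMonoidHom.flip (show N →+ F →+ D from f.toAddMonoidHom)) fun r x n => by
        change (f n : F →+ D) (r • x) = (f (r • n) : F →+ D) x
        rw [map_zsmul (f n : F →+ D), map_zsmul f]
        rfl)
    ((AddSubgroup.closure_le _).2 <| by
      rintro _ ⟨x, s, n, rfl⟩
      rw [SetLike.mem_coe, AddMonoidHom.mem_ker, map_sub, sub_eq_zero]
      exact (congrArg (fun q : RightDual S F D => q x) (f.map_smul s n)).symm)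

theorem BalancedTensor.smul_tmul (s : S) (x : F) (n : N) :
    (QuotientAddGroup.mk (x ⊗ₜ[ℤ] (s • n)) : BalancedTensor S F N) =
      QuotientAddGroup.mk ((MulOpposite.op s • x) ⊗ₜ[ℤ] n) := by
  rw [QuotientAddGroup.eq, neg_add_eq_sub]
  exact AddSubgroup.subset_closure ⟨x, s, n, rfl⟩

/-- The other direction of the tensor-hom adjunction for balanced tensor products. -/
def BalancedTensor.curry (f : BalancedTensor S F N →+ D) : N →ₗ[S] RightDual S F D where
  toFun n := f.comp ((QuotientAddGroup.mk' _).comp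
    ((TensorProduct.mk ℤ F N).flip n).toAddMonoidHom)
  map_add' n n' := by
    ext x
    change f (QuotientAddGroup.mk (x ⊗ₜ[ℤ] (n + n'))) =
      f (QuotientAddGroup.mk (x ⊗ₜ[ℤ] n)) + f (QuotientAddGroup.mk (x ⊗ₜ[ℤ] n'))
    rw [TensorProduct.tmul_add, QuotientAddGroup.mk_add, map_add]
  map_smul' s n := by
    ext x
    change f (QuotientAddGroup.mk (x ⊗ₜ[ℤ] (s • n))) =
      f (QuotientAddGroup.mk ((MulOpposite.op s • x) ⊗ₜ[ℤ] n))
    rw [BalancedTensor.smul_tmul]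

variable (D) in
/-- Lambek's criterion: the dual of a flat right module is an injective left module. -/
theorem IsFlatRight.injective_rightDual (hF : IsFlatRight S F) (hD : Module.Baer ℤ D) :
    Injective (ModuleCat.of S (RightDual S F D)) where
  factors {N P} f g hg := by
    rw [ModuleCat.mono_iff_injective] at hg
    obtain ⟨ψ, hψ⟩ := hD.extension_property_addMonoidHom _ (hF N P g.hom hg)
      (BalancedTensor.lift f.hom)
    refine ⟨ModuleCat.ofHom (BalancedTensor.curry ψ), ?_⟩
    ext n : 2
    refine RightDual.ext (S := S) fun x => ?_
    exact congrArg (fun t => t (QuotientAddGroup.mk (x ⊗ₜ[ℤ] n))) hψ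

end

variable {S} in
theorem HasFlatDimensionLE.hasInjectiveDimensionLT_rightDual {D : Type u} [AddCommGroup D]
    (hD : Module.Baer ℤ D) {n : ℕ} {X : ModuleCat.{u} Sᵐᵒᵖ} (hX : HasFlatDimensionLE S n X) :
    HasInjectiveDimensionLT (ModuleCat.of S (RightDual S X D)) (n + 1) := by
  induction n generalizing X with
  | zero =>
    rw [zero_add, ← injective_iff_hasInjectiveDimensionLT_one]
    exact IsFlatRight.injective_rightDual D hX hD
  | succ n ih =>
    obtain ⟨F, p, hF, hp, hK⟩ := hX
    have := IsFlatRight.injective_rightDual D hF hD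
    have hS : IsSES (ModuleCat.ofHom (RightDual.map D p))
        (ModuleCat.ofHom (RightDual.map D (LinearMap.ker p).subtype)) := by
      refine .of_exact (fun f g h => RightDual.ext (S := S) fun x => ?_) (fun f => ?_)
        fun f => ⟨fun h => ?_, ?_⟩
      · obtain ⟨x, rfl⟩ := hp x
        exact congrArg (fun q : RightDual S F D => q x) h
      · obtain ⟨q, hq⟩ := hD.extension_property_addMonoidHom
          (LinearMap.ker p).subtype.toAddMonoidHom Subtype.val_injective f
        exact ⟨q, hq⟩
      · have h1 : p.toAddMonoidHom.ker ≤ AddMonoidHom.ker f := fun x hx =>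
          congrArg (fun q : RightDual S (LinearMap.ker p) D => q ⟨x, hx⟩) h
        exact ⟨p.toAddMonoidHom.liftOfSurjective hp ⟨f, h1⟩,
          AddMonoidHom.liftOfRightInverse_comp _ _ _ _⟩
      · rintro ⟨f, rfl⟩
        refine RightDual.ext (S := S) fun x => ?_
        change f (p x) = 0
        rw [x.2]
        exact map_zero f
    exact (hS.shortExact.hasInjectiveDimensionLT_X₃_iff n this).1 (ih hK)

end RightDual

namespace TriangularMatrixRing

variable {S M R : Type u} [Ring S] [Ring R] [AddCommGroup M]
  [Module R M] [Module Sᵐᵒᵖ M] [SMulCommClass R Sᵐᵒᵖ M]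

theorem epi_coindFunctor_map
    (hpd : ∃ n : ℕ, HasProjectiveDimensionLE (ModuleCat.of R M) n)
    {A B D : ModuleCat.{u} R} {f : A ⟶ B} {g : B ⟶ D} (hS : IsSES f g)
    (hA : gorensteinInjective (ModuleCat.{u} R) A) : Epi ((coindFunctor S M R).map g) := by
  obtain ⟨n, hn⟩ := hpd
  have h1 := subsingleton_ext_gorensteinInjective_of_hasProjectiveDimensionLT _ hn hA 0
  have h2 := hS.epi
  rw [ModuleCat.epi_iff_surjective] at h2 ⊢
  rintro ⟨φ, d⟩
  obtain ⟨b, hb⟩ := h2 d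
  obtain ⟨ψ, hψ⟩ := hS.exists_lift_of_ext h1 (ModuleCat.ofHom φ)
  exact ⟨⟨ψ.hom, b⟩, Coind.ext (fun m => congrArg (fun q => q.hom m) hψ) hb⟩

/-- If `M` has finite flat dimension over `S`, then `Hom_R(M, E)` has finite injective dimension
over `S` for each injective `R`-module `E`: it is a direct summand of `Hom_ℤ(M, D)` for any
injective abelian group `D` containing `E`. -/
theorem hasInjectiveDimensionLT_corner_coindFunctor {n : ℕ}
    (hfd : HasFlatDimensionLE S n (ModuleCat.of Sᵐᵒᵖ M)) (E : ModuleCat.{u} R) [Injective E] :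
    HasInjectiveDimensionLT ((cornerFunctor (ofS S M R)).obj ((coindFunctor S M R).obj E))
      (n + 1) := by
  let D : ModuleCat.{u} ℤ := Injective.under (ModuleCat.of ℤ E)
  let j : E →+ D := (Injective.ι (ModuleCat.of ℤ E)).hom.toAddMonoidHom
  have hj : Function.Injective j := (ModuleCat.mono_iff_injective _).1 (Injective.ι_mono _)
  have hD' : Module.Baer ℤ D :=
    Module.Baer.of_injective (Module.injective_module_of_injective_object _ D
      (inj := Injective.injective_under (ModuleCat.of ℤ E)))
  -- Any two `ℤ`-module structures on `D` agree.
  have hD : @Module.Baer ℤ _ D _ (AddCommGroup.toIntModule D) := by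
    convert hD'
    exact Subsingleton.elim _ _
  -- `E` embeds into `Hom_ℤ(R, D)`, hence is a direct summand.
  let i : E →ₗ[R] RightDual R R D :=
    { toFun := fun y => j.comp ((smulAddHom R E).flip y)
      map_add' := fun y z => by
        refine RightDual.ext fun r => ?_
        change j (r • (y + z)) = j (r • y) + j (r • z)
        rw [smul_add, map_add]
      map_smul' := fun r y => by
        refine RightDual.ext fun r' => ?_
        change j (r' • r • y) = j ((r' * r) • y)
        rw [mul_smul] }
  have hi : Function.Injective i := fun y z h => hj (by
    have : j ((1 : R) • y) = j ((1 : R) • z) := congrArg (fun q : RightDual R R D => q 1) h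
    rwa [one_smul, one_smul] at this)
  have : Module.Injective R E := Module.injective_module_of_injective_object _ E
  obtain ⟨ρ, hρ⟩ := Module.Injective.out i hi LinearMap.id
  have hρ' (y : E) : ρ (i y) = y := hρ y
  let c : cornerSubgroup (ofS S M R) (Coind M R E) →ₗ[S] RightDual S M D :=
    { toFun := fun p => j.comp p.1.1.toAddMonoidHom
      map_add' := fun p q => RightDual.ext fun m => map_add j (p.1.1 m) (q.1.1 m)
      map_smul' := fun s p => rfl }
  let d₀ (f : RightDual S M D) (m : M) : RightDual R R D :=
    AddMonoidHom.comp f ((smulAddHom R M).flip m)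
  let d₁ (f : RightDual S M D) : M →ₗ[R] E :=
    { toFun := fun m => ρ (d₀ f m)
      map_add' := fun m m' => by
        rw [← map_add]
        refine congrArg ρ (RightDual.ext fun r => ?_)
        change f (r • (m + m')) = f (r • m) + f (r • m')
        rw [smul_add, map_add]
      map_smul' := fun r m => by
        rw [RingHom.id_apply, ← map_smul]
        refine congrArg ρ (RightDual.ext fun r' => ?_)
        change f (r' • r • m) = f ((r' * r) • m)
        rw [mul_smul] }
  let d : RightDual S M D →ₗ[S] cornerSubgroup (ofS S M R) (Coind M R E) :=
    { toFun := fun f => ⟨(d₁ f, 0), Coind.ext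
        (fun m => congrArg (d₁ f) (one_smul Sᵐᵒᵖ m)) (by
          change d₁ f 0 + (0 : R) • (0 : E) = 0
          rw [map_zero, smul_zero, add_zero])⟩
      map_add' := fun f g => Subtype.ext (Coind.ext
        (fun m => map_add ρ (d₀ f m) (d₀ g m)) (add_zero (0 : E)).symm)
      map_smul' := fun s f => Subtype.ext (Coind.ext (fun m => by
        change ρ (d₀ (s • f) m) = ρ (d₀ f (MulOpposite.op s • m))
        refine congrArg ρ (RightDual.ext fun r => ?_)
        change f (MulOpposite.op s • r • m) = f (r • MulOpposite.op s • m)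
        rw [smul_comm r]) (by
          change (0 : E) = d₁ f 0 + (0 : R) • (0 : E)
          rw [map_zero, smul_zero, add_zero])) }
  have hcd (p) : d (c p) = p := by
    refine Subtype.ext (Coind.ext (fun m => ?_) ?_)
    · have h1 : d₀ (c p) m = i (p.1.1 m) := RightDual.ext fun r =>
        congrArg j (map_smul p.1.1 r m)
      change ρ (d₀ (c p) m) = _
      rw [h1, hρ']
    · have h1 : p.1.1 0 + (0 : R) • p.1.2 = p.1.2 := congrArg Prod.snd p.2
      change (0 : E) = p.1.2
      rw [← h1, map_zero, zero_smul, add_zero]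
  have := hfd.hasInjectiveDimensionLT_rightDual hD
  refine Retract.hasInjectiveDimensionLT (Y := ModuleCat.of S (RightDual S M D))
    ⟨ModuleCat.ofHom c, ModuleCat.ofHom d, ?_⟩ (n + 1)
  exact ModuleCat.hom_ext (LinearMap.ext hcd)

variable (S M R) in
theorem isCompatible_recollement
    (hpd : ∃ n : ℕ, HasProjectiveDimensionLE (ModuleCat.of R M) n)
    (hfd : ∃ n : ℕ, HasFlatDimensionLE S n (ModuleCat.of Sᵐᵒᵖ M)) :
    (recollement S M R).IsCompatible where
  epi_map_h hS hA := epi_coindFunctor_map hpd hS hA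
  exists_injectiveDimension E _ := by
    obtain ⟨n, hn⟩ := hfd
    exact ⟨n + 1, hasInjectiveDimensionLT_corner_coindFunctor hn E⟩

end TriangularMatrixRing

theorem mainTheorem5 {S M R : Type u} [Ring S] [Ring R] [AddCommGroup M]
    [Module R M] [Module Sᵐᵒᵖ M] [SMulCommClass R Sᵐᵒᵖ M]
    (hpd : ∃ n : ℕ, HasProjectiveDimensionLE (ModuleCat.of R M) n)
    (hfd : ∃ n : ℕ, HasFlatDimensionLE S n (ModuleCat.of Sᵐᵒᵖ M)) :
    IsSpecialPreenveloping
        (gorensteinInjective (ModuleCat.{u} (TriangularMatrixRing S M R))) ↔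
      IsSpecialPreenveloping (gorensteinInjective (ModuleCat.{u} R)) ∧
        IsSpecialPreenveloping (gorensteinInjective (ModuleCat.{u} S)) :=
  (TriangularMatrixRing.isCompatible_recollement S M R hpd hfd).isSpecialPreenveloping_iff
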